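/- **Setting.** Let $m\ge 1$, let $\mathbb D$ be the open unit disk and $\mathbb T$ the unit circle, and let $L^2$ and $H^2$ be the $\mathbb C^m$-valued Lebesgue and Hardy spaces on $\mathbb T$ (functions in $H^2$ are identified with their analytic extensions to $\mathbb D$). Let $P$ be the orthogonal projection of $L^2$ onto $H^2$. For a continuous $\varphi:\mathbb T\to\mathbb C^{m\times m}$ with Fourier coefficients $\varphi_n$ define the following. - $T(\varphi)f=P(\varphi f)$ and $H(\varphi)f=P(\varphi\cdot(I-P)Jf)$ on $H^2$, where $(Jf)(t)=t^{-1}f(t^{-1})$, and $\tilde\varphi(t)=\varphi(1/t)$. - For a scalar inner function $u$ put $K_u=H^2\ominus uH^2$, let $P_u$ be the orthogonal projection of $H^2$ onto $K_u$, and put $Q_u=I-P_u$ and $T_u(\varphi)=P_uT(\varphi)|K_u$. - For $\alpha\in\mathbb D$ put $\mu_\alpha(z)=\frac{z-\alpha}{1-\bar\alpha z}$ and $B_\alpha(z)=\frac{-\bar\alpha}{|\alpha|}\,\frac{z-\alpha}{1-\bar\alpha z}$, with $B_0(z)=z$. - If $\det\varphi$ has a continuous logarithm on $\mathbb T$, put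 $G(\varphi)=\exp\left(\frac1{2\pi}\int_0^{2\pi}\log\det\varphi(e^{i\theta})\,d\theta\right)$, with any continuous logarithm. - Let $\mathcal A$ be the set of all $\varphi$ with $\sum_{n\in\mathbb Z}\|\varphi_n\|+\sum_{n\in\mathbb Z}|n|\,\|\varphi_n\|^2<\infty$. **Theorem.** Let $a\in\mathcal A$ have factorizations $a=w_-w_+=v_+v_-$ such that $w_\pm,v_\pm$ are invertible on $\mathbb T$, the functions $w_\pm,v_\pm$ and their inverses lie in $\mathcal A$, the Fourier coefficients with negative index of $w_+^{\pm1},v_+^{\pm1}$ vanish, and the Fourier coefficients with positive index of $w_-^{\pm1},v_-^{\pm1}$ vanish. Put $b=v_-w_+^{-1}$ and $c=w_-^{-1}v_+$. Let $(\alpha_j)_{j\ge1}$ be a sequence in $\mathbb D$ and $u_N=\prod_{j=1}^N B_{\alpha_j}$. Then $K_{u_N}$ is finite-dimensional for all $N$, $\det(a\circ\mu_{-\beta})$ has a continuous logarithm on $\mathbb T$ for all $\beta\in\mathbb D$, the operator $H(b)H(\tilde c)$ is of trace class, and $\det(I-H(b)H(\tilde c))\neq0$. Moreover, the following hold. 1.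 If $\sum_{j}(1-|\alpha_j|)=\infty$, then $u_N(z)\to0$ for every $z\in\mathbb D$, $Q_{u_N}\to0$ strongly on $H^2$, and $$\lim_{N\to\infty}\det T_{u_N}(a)\prod_{j=1}^N G(a\circ\mu_{-\alpha_j})^{-1}=\frac1{\det(I-H(b)H(\tilde c))}.$$ 2. If $\sum_{j}(1-|\alpha_j|)<\infty$, then the infinite Blaschke product $B(z)=\prod_{j=1}^\infty B_{\alpha_j}(z)$ converges unconditionally and $u_N(z)\to B(z)$ for every $z\in\mathbb D$, $Q_{u_N}\to Q_B$ strongly on $H^2$, $Q_BH(b)H(\tilde c)Q_B$ is of trace class, and $$\lim_{N\to\infty}\det T_{u_N}(a)\prod_{j=1}^N G(a\circ\mu_{-\alpha_j})^{-1}=\frac{\det(I-Q_BH(b)H(\tilde c)Q_B)}{\det(I-H(b)H(\tilde c))}.$$ Here $\det(I-A)$ for a trace class operator $A$ is the Fredholm determinant. -/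

import Mathlib

open MeasureTheory Filter Topology Complex
open scoped ENNReal ComplexConjugate UnitDisc Matrix.Norms.Elementwise

noncomputable section

namespace ModelSpace

/-! ### `L²`, `H²` and Fourier coefficients -/

instance factTwoPiPos : Fact (0 < 2 * Real.pi) := ⟨Real.two_pi_pos⟩

/-- The parameter circle `ℝ / 2πℤ`; its points `θ` parametrize the unit circle by
`t = e^{iθ} = θ.toCircle`, and it carries the normalized Haar measure `dθ / 2π`. -/
abbrev Angle : Type := AddCircle (2 * Real.pi)

/-- The normalized Lebesgue measure on the circle. -/
abbrev σ : Measure Angle := AddCircle.haarAddCircle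

/-- `ℂᵐ` with its Euclidean norm. -/
abbrev Vec (m : ℕ) : Type := EuclideanSpace ℂ (Fin m)

/-- The space `L²` of `ℂᵐ`-valued functions on the unit circle. -/
abbrev L2 (m : ℕ) : Type := Lp (Vec m) 2 σ

/-- The `n`-th Fourier coefficient of a function in `L²`, as a continuous linear map. -/
def coeffCLM (m : ℕ) (n : ℤ) : L2 m →L[ℂ] Vec m :=
  LinearMap.mkContinuous
    { toFun := fun f => fourierCoeff (f : Angle → Vec m) n
      map_add' := fun f g => by
        have hf : Integrable (f : Angle → Vec m) σ :=
          (Lp.memLp f).integrable (by norm_num)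
        have hg : Integrable (g : Angle → Vec m) σ :=
          (Lp.memLp g).integrable (by norm_num)
        rw [fourierCoeff_congr_ae (Lp.coeFn_add f g), fourierCoeff.add hf hg]
        rfl
      map_smul' := fun c f => by
        rw [fourierCoeff_congr_ae (Lp.coeFn_smul c f), fourierCoeff.const_smul]
        rfl } 1
    (fun f => by
      have h2 : eLpNorm (f : Angle → Vec m) 1 σ ≤ eLpNorm (f : Angle → Vec m) 2 σ :=
        eLpNorm_le_eLpNorm_of_exponent_le (by norm_num) (Lp.aestronglyMeasurable f)
      have h3 : ∫ θ, ‖(f : Angle → Vec m) θ‖ ∂σ ≤ ‖f‖ := by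
        rw [integral_norm_eq_lintegral_enorm (Lp.aestronglyMeasurable f),
          ← eLpNorm_one_eq_lintegral_enorm, Lp.norm_def]
        exact ENNReal.toReal_mono (Lp.eLpNorm_ne_top f) h2
      rw [one_mul]
      refine le_trans ?_ h3
      refine (norm_integral_le_integral_norm _).trans (le_of_eq ?_)
      refine integral_congr_ae (Eventually.of_forall fun θ => ?_)
      simp [norm_smul, Circle.norm_coe])

/-- The Hardy space `H²` of the circle: the functions in `L²` whose Fourier coefficients of
negative index vanish. -/
def H2 (m : ℕ) : Submodule ℂ (L2 m) :=
  ⨅ n : {n : ℤ // n < 0}, LinearMap.ker (coeffCLM m n : L2 m →ₗ[ℂ] Vec m)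

theorem mem_H2 {m : ℕ} {f : L2 m} :
    f ∈ H2 m ↔ ∀ n : ℤ, n < 0 → fourierCoeff (f : Angle → Vec m) n = 0 := by
  simp only [H2, Submodule.mem_iInf, LinearMap.mem_ker, Subtype.forall]
  rfl

instance completeSpace_H2 (m : ℕ) : CompleteSpace (H2 m) := by
  have h : IsClosed (H2 m : Set (L2 m)) := by
    rw [H2, Submodule.coe_iInf]
    exact isClosed_iInter fun n => (coeffCLM m n).isClosed_ker
  exact h.completeSpace_coe

/-- The value at `z` in the unit disk of the analytic function with boundary function `f ∈ H²`,
that is, the sum of the power series whose coefficients are the Fourier coefficients of `f`. -/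
def diskValue {m : ℕ} (f : H2 m) (z : 𝔻) : Vec m :=
  ∑' n : ℕ, (z : ℂ) ^ n • coeffCLM m n (f : L2 m)

theorem summable_diskValue {m : ℕ} (f : H2 m) (z : 𝔻) :
    Summable fun n : ℕ => (z : ℂ) ^ n • coeffCLM m n (f : L2 m) := by
  refine Summable.of_norm_bounded (g := fun n : ℕ => ‖(z : ℂ)‖ ^ n * ‖(f : L2 m)‖)
    ((summable_geometric_of_lt_one (norm_nonneg _) z.norm_lt_one).mul_right _) fun n => ?_
  rw [norm_smul, norm_pow]
  have h : ‖coeffCLM m n (f : L2 m)‖ ≤ 1 * ‖(f : L2 m)‖ :=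
    (coeffCLM m n).le_of_opNorm_le
      (LinearMap.mkContinuous_norm_le _ zero_le_one _) (f : L2 m)
  rw [one_mul] at h
  gcongr

/-! ### Multiplication, Toeplitz and Hankel operators -/

/-- The compression `P_V A | V` of an operator `A` to a subspace `V`. -/
def compress {E : Type*} [NormedAddCommGroup E] [InnerProductSpace ℂ E] (V : Submodule ℂ E)
    [V.HasOrthogonalProjection] (A : E →L[ℂ] E) : V →L[ℂ] V :=
  V.orthogonalProjectionOnto ∘L A ∘L V.subtypeL

/-- Continuous `m × m` matrix functions on the unit circle. -/
abbrev Symbol (m : ℕ) : Type := C(Circle, Matrix (Fin m) (Fin m) ℂ)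

/-- A symbol as an operator-valued function of the angle. -/
def Symbol.toCLM {m : ℕ} (a : Symbol m) : C(Angle, Vec m →L[ℂ] Vec m) where
  toFun θ := Matrix.toEuclideanCLM (n := Fin m) (𝕜 := ℂ) (a θ.toCircle)
  continuous_toFun :=
    (LinearMap.continuous_of_finiteDimensional
      ((Matrix.toEuclideanCLM (n := Fin m) (𝕜 := ℂ)).toAlgEquiv.toLinearMap)).comp
      (a.continuous.comp AddCircle.continuous_toCircle)

/-- The operator of multiplication by the matrix function `a` on `L²`. -/
def mulOp {m : ℕ} (a : Symbol m) : L2 m →L[ℂ] L2 m :=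
  (ContinuousLinearMap.id ℂ (Vec m →L[ℂ] Vec m)).holderL σ ∞ 2 2
    (ContinuousMap.toLp ∞ σ ℂ a.toCLM)

/-- The symbol `t ↦ t⁻¹ I`. -/
def invSymbol (m : ℕ) : Symbol m where
  toFun t := ((t⁻¹ : Circle) : ℂ) • (1 : Matrix (Fin m) (Fin m) ℂ)
  continuous_toFun := by fun_prop

/-- The flip operator `(J f)(t) = t⁻¹ f(t⁻¹)` on `L²`. -/
def flipOp (m : ℕ) : L2 m →L[ℂ] L2 m :=
  mulOp (invSymbol m) ∘L
    (Lp.compMeasurePreservingₗᵢ ℂ (fun θ : Angle => -θ)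
      (Measure.measurePreserving_neg σ)).toContinuousLinearMap

/-- The Toeplitz operator `T(a) f = P (a f)` on `H²`. -/
def toeplitz {m : ℕ} (a : Symbol m) : H2 m →L[ℂ] H2 m := compress (H2 m) (mulOp a)

/-- The Hankel operator `H(a) f = P (a · (I - P) J f)` on `H²`. -/
def hankel {m : ℕ} (a : Symbol m) : H2 m →L[ℂ] H2 m :=
  (H2 m).orthogonalProjectionOnto ∘L mulOp a ∘L (1 - (H2 m).starProjection) ∘L
    flipOp m ∘L (H2 m).subtypeL

/-- The reversal `ã(t) = a(1/t)`. -/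
def reversal {m : ℕ} (a : Symbol m) : Symbol m := a.comp ⟨fun t : Circle => t⁻¹, continuous_inv⟩

/-! ### The Wiener and Krein algebras and Wiener–Hopf factors -/

/-- The `n`-th matrix Fourier coefficient of a symbol. -/
def Symbol.coeff {m : ℕ} (a : Symbol m) (n : ℤ) : Matrix (Fin m) (Fin m) ℂ :=
  fourierCoeff (fun θ : Angle => a θ.toCircle) n

/-- Membership in the intersection of the Wiener algebra and the Krein algebra
`K_{2,2}^{1/2,1/2}`; the choice of the matrix norm (here the maximum of the moduli of the entries)
is immaterial. -/
def InWienerKrein {m : ℕ} (a : Symbol m) : Prop :=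
  (Summable fun n : ℤ => ‖a.coeff n‖) ∧ Summable fun n : ℤ => |(n : ℝ)| * ‖a.coeff n‖ ^ 2

/-- `a ∈ H^∞`. -/
def Symbol.IsAnalytic {m : ℕ} (a : Symbol m) : Prop := ∀ n : ℤ, n < 0 → a.coeff n = 0

/-- The complex conjugate of `a` belongs to `H^∞`. -/
def Symbol.IsCoanalytic {m : ℕ} (a : Symbol m) : Prop := ∀ n : ℤ, 0 < n → a.coeff n = 0

/-- A factor of plus type: `w` and `w⁻¹` lie in the Wiener and Krein algebras and in `H^∞`. -/
structure IsPlusFactor {m : ℕ} (w : (Symbol m)ˣ) : Prop where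
  mem : InWienerKrein (w : Symbol m)
  mem_inv : InWienerKrein ((w⁻¹ : (Symbol m)ˣ) : Symbol m)
  analytic : (w : Symbol m).IsAnalytic
  analytic_inv : ((w⁻¹ : (Symbol m)ˣ) : Symbol m).IsAnalytic

/-- A factor of minus type: the complex conjugate of `w` is of plus type. -/
structure IsMinusFactor {m : ℕ} (w : (Symbol m)ˣ) : Prop where
  mem : InWienerKrein (w : Symbol m)
  mem_inv : InWienerKrein ((w⁻¹ : (Symbol m)ˣ) : Symbol m)
  coanalytic : (w : Symbol m).IsCoanalytic
  coanalytic_inv : ((w⁻¹ : (Symbol m)ˣ) : Symbol m).IsCoanalytic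

/-! ### Model spaces -/

/-- The subspace `u H²` of `H²`, for a scalar function `u` on the unit disk. -/
def mulH2 (m : ℕ) (u : 𝔻 → ℂ) : Submodule ℂ (H2 m) where
  carrier := {f | ∃ g : H2 m, ∀ z : 𝔻, diskValue f z = u z • diskValue g z}
  zero_mem' := ⟨0, fun z => by simp [diskValue]⟩
  add_mem' := by
    rintro f₁ f₂ ⟨g₁, h₁⟩ ⟨g₂, h₂⟩
    have hadd : ∀ (f g : H2 m) (z : 𝔻), diskValue (f + g) z = diskValue f z + diskValue g z := by
      intro f g z
      simp only [diskValue, Submodule.coe_add, map_add, smul_add]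
      exact (summable_diskValue f z).tsum_add (summable_diskValue g z)
    exact ⟨g₁ + g₂, fun z => by rw [hadd, hadd, h₁, h₂, smul_add]⟩
  smul_mem' := by
    rintro c f ⟨g, h⟩
    have hsmul : ∀ (f : H2 m) (z : 𝔻), diskValue (c • f) z = c • diskValue f z := by
      intro f z
      simp only [diskValue, Submodule.coe_smul, map_smul]
      rw [← (summable_diskValue f z).tsum_const_smul]
      exact tsum_congr fun n => smul_comm _ _ _
    exact ⟨c • g, fun z => by rw [hsmul, hsmul, h, smul_comm]⟩

/-- The model space `K_u = H² ⊖ u H²`. -/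
def modelSpace (m : ℕ) (u : 𝔻 → ℂ) : Submodule ℂ (H2 m) := (mulH2 m u)ᗮ

instance completeSpace_modelSpace (m : ℕ) (u : 𝔻 → ℂ) : CompleteSpace (modelSpace m u) :=
  inferInstanceAs (CompleteSpace (mulH2 m u)ᗮ)

/-- `Q_u = I - P_u`, where `P_u` is the orthogonal projection of `H²` onto `K_u`. -/
def projQ (m : ℕ) (u : 𝔻 → ℂ) : H2 m →L[ℂ] H2 m := 1 - (modelSpace m u).starProjection

/-- The Toeplitz operator `T_u(a) = P_u T(a) | K_u` on the model space. -/
def modelToeplitz {m : ℕ} (u : 𝔻 → ℂ) (a : Symbol m) : modelSpace m u →L[ℂ] modelSpace m u :=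
  compress (modelSpace m u) (toeplitz a)

/-! ### Blaschke products and geometric means -/

/-- The Blaschke factor `B_α(z) = -(ᾱ / |α|) (z - α) / (1 - ᾱ z)`, with `B_0(z) = z`. -/
def blaschkeFactor (α z : 𝔻) : ℂ :=
  open Classical in
  if α = 0 then (z : ℂ) else
    -conj (α : ℂ) / (‖(α : ℂ)‖ : ℂ) * (((z : ℂ) - α) / (1 - conj (α : ℂ) * z))

/-- The partial product `u_N = B_{α_0} ⋯ B_{α_{N-1}}` for a sequence `α_0, α_1, …`. -/
def partialBlaschke (α : ℕ → 𝔻) (N : ℕ) (z : 𝔻) : ℂ :=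
  ∏ j ∈ Finset.range N, blaschkeFactor (α j) z

/-- The infinite Blaschke product. -/
def infiniteBlaschke (α : ℕ → 𝔻) (z : 𝔻) : ℂ := ∏' j, blaschkeFactor (α j) z

theorem mobius_denom_ne_zero (α : 𝔻) (t : Circle) : 1 - conj (α : ℂ) * (t : ℂ) ≠ 0 := by
  intro h
  have h1 : ‖conj (α : ℂ) * (t : ℂ)‖ = 1 := by
    rw [← sub_eq_zero.mp h, norm_one]
  rw [norm_mul, Circle.norm_coe, mul_one, RCLike.norm_conj] at h1
  exact α.norm_ne_one h1

/-- The Möbius map `μ_α(t) = (t - α) / (1 - ᾱ t)` as a continuous map of the unit circle. -/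
def mobius (α : 𝔻) : C(Circle, Circle) where
  toFun t := ⟨((t : ℂ) - α) / (1 - conj (α : ℂ) * t), by
    have hd := mobius_denom_ne_zero α t
    have key : ‖(t : ℂ) - α‖ = ‖1 - conj (α : ℂ) * t‖ := by
      have h : (1 - conj (α : ℂ) * t) = t * conj ((t : ℂ) - α) := by
        have ht : (t : ℂ) * conj (t : ℂ) = 1 := by
          rw [Complex.mul_conj, Circle.normSq_coe, Complex.ofReal_one]
        rw [map_sub, mul_sub, ht]
        ring
      rw [h, norm_mul, Circle.norm_coe, one_mul, RCLike.norm_conj]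
    change _ ∈ Metric.sphere (0 : ℂ) 1
    rw [mem_sphere_zero_iff_norm, norm_div, key, div_self (norm_ne_zero_iff.mpr hd)]⟩
  continuous_toFun := by
    refine Continuous.subtype_mk ?_ _
    exact Continuous.div (by fun_prop) (by fun_prop) (mobius_denom_ne_zero α)

/-- `ℓ` is a continuous logarithm of `det φ` on the unit circle. -/
def IsLogDet {m : ℕ} (φ : Symbol m) (ℓ : C(Circle, ℂ)) : Prop :=
  ∀ t : Circle, Complex.exp (ℓ t) = (φ t).det

open Classical in
/-- The geometric mean `G(φ) = exp ((1/2π) ∫₀^{2π} log det φ(e^{iθ}) dθ)`, where `log det φ` is a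
continuous logarithm of `det φ`. Two such logarithms differ by a constant in `2πiℤ`, so the value
does not depend on the choice; it is set to `0` if there is no continuous logarithm. -/
def geomMean {m : ℕ} (φ : Symbol m) : ℂ :=
  if h : ∃ ℓ : C(Circle, ℂ), IsLogDet φ ℓ then
    Complex.exp (((1 / (2 * Real.pi) : ℝ) : ℂ) *
      ∫ θ in (0 : ℝ)..(2 * Real.pi), h.choose (Circle.exp θ))
  else 0

/-! ### Determinants of identity minus trace class -/

section Determinant

variable {E : Type*} [NormedAddCommGroup E] [InnerProductSpace ℂ E]

/-- Trace class operators: the trace norm, which is the supremum of the sums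
`∑ |⟨e_i, A f_i⟩|` over all pairs of finite orthonormal systems, is finite. -/
def IsTraceClass (A : E →L[ℂ] E) : Prop :=
  ∃ C : ℝ, ∀ (n : ℕ) (e f : Fin n → E), Orthonormal ℂ e → Orthonormal ℂ f →
    ∑ i, ‖inner ℂ (e i) (A (f i))‖ ≤ C

/-- The determinant of the compression of `A` to a finite-dimensional subspace `V`. -/
def detCompress (A : E →L[ℂ] E) (V : {V : Submodule ℂ E // FiniteDimensional ℂ V}) : ℂ :=
  haveI := V.2
  LinearMap.det (compress V.1 A : V.1 →ₗ[ℂ] V.1)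

/-- `A` is of trace class and `d` is the (Fredholm) determinant `det (I - A)`: the limit of
the determinants of the compressions of `I - A` to the finite-dimensional subspaces, directed by
inclusion. -/
def IsDetOneSub (A : E →L[ℂ] E) (d : ℂ) : Prop :=
  IsTraceClass A ∧ Tendsto (detCompress (1 - A)) atTop (𝓝 d)

end Determinant

/-- The normalized determinant `det T_{u_N}(a) ∏_{α ∈ σ(u_N)} G(a ∘ μ_{-α})⁻¹`. -/
def normalizedDet {m : ℕ} (a : Symbol m) (α : ℕ → 𝔻) (N : ℕ) : ℂ :=
  LinearMap.det (modelToeplitz (partialBlaschke α N) a :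
      modelSpace m (partialBlaschke α N) →ₗ[ℂ] modelSpace m (partialBlaschke α N)) *
    ∏ j ∈ Finset.range N, (geomMean (a.comp (mobius (-(α j)))))⁻¹

/-- The operator `H(b) H(c̃)`. -/
def hankelProduct {m : ℕ} (b c : Symbol m) : H2 m →L[ℂ] H2 m :=
  hankel b ∘L hankel (reversal c)

end ModelSpace

end

/-!
Since `b c = 1`, the operator `I - H(b) H(c̃)` equals `T(b) T(c) = T(v₋) T(w₊⁻¹) T(w₋⁻¹) T(v₊)`,
whose inverse is `X = T(v₊⁻¹) T(a) T(v₋⁻¹)`. The coanalytic Toeplitz operators `T(v₋)` and `T(v₊)*`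
leave every `K_{u_j}` invariant, and on the quotient `K_{u_j} / K_{u_{j-1}}` they act through the
values of the harmonic extensions of `v₋` and `v₊*` at `α_j`. Hence
`det T_{u_N}(a) = ∏ G(a ∘ μ_{-α_j}) · det P_{u_N} X P_{u_N}`, and Jacobi's identity for
complementary minors turns the last factor into
`det (I - Q_{u_N} H(b) H(c̃) Q_{u_N}) / det (I - H(b) H(c̃))`.
Finally `H(b) H(c̃)` is a product of two Hilbert–Schmidt operators, so that strong convergence of
`Q_{u_N}` is enough for these determinants to converge. The divergent case is the case in which
the limit of `u_N` is `0`.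
-/

noncomputable section

namespace ModelSpace

/-! ### Determinants of compressions to finite-dimensional subspaces -/

section DetCompress

variable {E : Type*} [NormedAddCommGroup E] [InnerProductSpace ℂ E]

/-- The finite-dimensional subspaces of `E`, directed by inclusion: the index set of the limit in
`IsDetOneSub`. -/
abbrev FinSubspace (E : Type*) [NormedAddCommGroup E] [InnerProductSpace ℂ E] : Type _ :=
  {V : Submodule ℂ E // FiniteDimensional ℂ V}

instance finiteDimensional_finSubspace (V : FinSubspace E) : FiniteDimensional ℂ V.1 := V.2

instance nonempty_finSubspace : Nonempty (FinSubspace E) := ⟨⟨⊥, inferInstance⟩⟩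

instance isDirectedOrder_finSubspace : IsDirectedOrder (FinSubspace E) where
  directed V W :=
    ⟨⟨V.1 ⊔ W.1, inferInstance⟩, le_sup_left (a := V.1), le_sup_right (a := V.1)⟩

lemma tendsto_starProjection_finSubspace (x : E) :
    Tendsto (fun V : FinSubspace E => V.1.starProjection x) atTop (𝓝 x) := by
  refine tendsto_const_nhds.congr' ?_
  filter_upwards [Ici_mem_atTop (⟨Submodule.span ℂ {x}, inferInstance⟩ : FinSubspace E)] with V hV
  have hV : Submodule.span ℂ {x} ≤ V.1 := hV
  exact (Submodule.starProjection_eq_self_iff.mpr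
    (hV (Submodule.mem_span_singleton_self x))).symm

lemma compress_sub (A B : E →L[ℂ] E) (V : Submodule ℂ E) [V.HasOrthogonalProjection] :
    compress V (A - B) = compress V A - compress V B := by
  ext x
  simp [compress]

lemma compress_one (V : Submodule ℂ E) [V.HasOrthogonalProjection] :
    compress V (1 : E →L[ℂ] E) = 1 := by
  ext x
  simp [compress]

lemma detCompress_congr {A B : E →L[ℂ] E} {V : FinSubspace E}
    (h : ∀ x ∈ V.1, ∀ y ∈ V.1, inner ℂ y (A x) = inner ℂ y (B x)) :
    detCompress A V = detCompress B V := by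
  unfold detCompress
  congr 2
  ext x
  congr 1
  refine ext_inner_left ℂ fun y => ?_
  simpa [compress] using h x x.2 y y.2

lemma detCompress_eq_one {A : E →L[ℂ] E} {V : FinSubspace E} (h : ∀ x ∈ V.1, A x = x) :
    detCompress A V = 1 := by
  rw [detCompress_congr (B := 1) fun x hx y _ => by simp [h x hx]]
  unfold detCompress
  rw [compress_one]
  exact LinearMap.det_id

lemma detCompress_comp_of_mapsTo (A : E →L[ℂ] E) {B : E →L[ℂ] E} {V : FinSubspace E}
    (hB : ∀ x ∈ V.1, B x ∈ V.1) :
    detCompress (A ∘L B) V = detCompress A V * detCompress B V := by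
  unfold detCompress
  rw [← LinearMap.det_comp]
  congr 1
  ext x
  have h : ((V.1.orthogonalProjectionOnto (B x) : V.1) : E) = B x :=
    Submodule.starProjection_eq_self_iff.mpr (hB x x.2)
  simp [compress, h]

lemma span_range_coe_orthonormalBasis {ι : Type*} [Fintype ι] {V : Submodule ℂ E}
    (e : OrthonormalBasis ι ℂ V) : Submodule.span ℂ (Set.range fun i => (e i : E)) = V := by
  have h := congrArg (Submodule.map V.subtype) e.toBasis.span_eq
  rw [Submodule.map_span, ← Set.range_comp, Submodule.map_subtype_top] at h
  simpa [Function.comp_def] using h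

lemma detCompress_eq_det_inner {ι : Type*} [Fintype ι] [DecidableEq ι] (A : E →L[ℂ] E)
    {V : FinSubspace E} {e : ι → E} (he : Orthonormal ℂ e)
    (hV : Submodule.span ℂ (Set.range e) = V.1) :
    detCompress A V = (Matrix.of fun i j => inner ℂ (e i) (A (e j))).det := by
  obtain ⟨V, _⟩ := V
  subst hV
  let f : OrthonormalBasis ι ℂ (Submodule.span ℂ (Set.range e)) :=
    (Module.Basis.span he.linearIndependent).toOrthonormalBasis (by
      convert! orthonormal_span he using 2
      exact Module.Basis.span_apply _ _)
  have hf : ∀ i, (f i : E) = e i := fun i => by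
    simp only [f, Module.Basis.coe_toOrthonormalBasis]
    exact Module.Basis.coe_span_apply _ _
  simp only [detCompress]
  rw [← LinearMap.det_toMatrix f.toBasis]
  congr 1
  ext i j
  simp [LinearMap.toMatrix_apply, compress, OrthonormalBasis.repr_apply_apply, hf]

lemma detCompress_adjoint [CompleteSpace E] (A : E →L[ℂ] E) (V : FinSubspace E) :
    detCompress (ContinuousLinearMap.adjoint A) V = conj (detCompress A V) := by
  set e := stdOrthonormalBasis ℂ V.1
  have he : Orthonormal ℂ fun i => (e i : E) := e.orthonormal.comp_linearIsometry V.1.subtypeₗᵢ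
  have hspan := span_range_coe_orthonormalBasis e
  rw [detCompress_eq_det_inner _ he hspan, detCompress_eq_det_inner A he hspan,
    starRingEnd_apply, ← Matrix.det_conjTranspose]
  congr 1
  ext i j
  simp [Matrix.conjTranspose_apply, ContinuousLinearMap.adjoint_inner_right]

lemma detCompress_comp_of_adjoint_mapsTo [CompleteSpace E] {A : E →L[ℂ] E} (B : E →L[ℂ] E)
    {V : FinSubspace E} (hA : ∀ x ∈ V.1, ContinuousLinearMap.adjoint A x ∈ V.1) :
    detCompress (A ∘L B) V = detCompress A V * detCompress B V := by
  apply (starRingEnd ℂ).injective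
  rw [map_mul, ← detCompress_adjoint, ← detCompress_adjoint, ← detCompress_adjoint,
    ContinuousLinearMap.adjoint_comp, detCompress_comp_of_mapsTo _ hA, mul_comm]

lemma detCompress_sup {V V' W : FinSubspace E} (hW : W.1 = V.1 ⊔ V'.1) (horth : V.1 ⟂ V'.1)
    {A : E →L[ℂ] E} (hA : ∀ x ∈ V.1, ∀ y ∈ V'.1, inner ℂ y (A x) = 0) :
    detCompress A W = detCompress A V * detCompress A V' := by
  set e := stdOrthonormalBasis ℂ V.1
  set f := stdOrthonormalBasis ℂ V'.1
  have he : Orthonormal ℂ fun i => (e i : E) := e.orthonormal.comp_linearIsometry V.1.subtypeₗᵢ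
  have hf : Orthonormal ℂ fun i => (f i : E) := f.orthonormal.comp_linearIsometry V'.1.subtypeₗᵢ
  set g := Sum.elim (fun i => (e i : E)) (fun i => (f i : E)) with hg_def
  have hg : Orthonormal ℂ g := by
    rw [orthonormal_iff_ite] at he hf ⊢
    rintro (i | i) (j | j)
    · simpa [g] using he i j
    · simpa [g] using Submodule.isOrtho_iff_inner_eq.mp horth _ (e i).2 _ (f j).2
    · simpa [g] using Submodule.isOrtho_iff_inner_eq.mp horth.symm _ (f i).2 _ (e j).2
    · simpa [g] using hf i j
  have hspan : Submodule.span ℂ (Set.range g) = W.1 := by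
    rw [hg_def, hW, Set.Sum.elim_range, Submodule.span_union, span_range_coe_orthonormalBasis,
      span_range_coe_orthonormalBasis]
  rw [detCompress_eq_det_inner A hg hspan,
    detCompress_eq_det_inner A he (span_range_coe_orthonormalBasis e),
    detCompress_eq_det_inner A hf (span_range_coe_orthonormalBasis f),
    ← Matrix.det_fromBlocks_zero₂₁ _ (Matrix.of fun i j => inner ℂ (e i : E) (A (f j)))]
  congr 1
  ext (i | i) (j | j)
  · rfl
  · rfl
  · simpa [g] using hA _ (e j).2 _ (f i).2
  · rfl

lemma detCompress_range_of_inner {G : Type*} [AddCommGroup G] [Module ℂ G] [FiniteDimensional ℂ G]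
    {L : G →ₗ[ℂ] E} (hL : Function.Injective L) {A : E →L[ℂ] E} {F : G →ₗ[ℂ] G}
    (h : ∀ u x, inner ℂ (L u) (A (L x)) = inner ℂ (L u) (L (F x))) :
    detCompress A ⟨LinearMap.range L, inferInstance⟩ = LinearMap.det F := by
  let e := LinearEquiv.ofInjective L hL
  rw [← LinearMap.det_conj F e]
  unfold detCompress
  congr 1
  refine LinearMap.ext fun y => ext_inner_left ℂ fun v => ?_
  obtain ⟨x, rfl⟩ := e.surjective y
  obtain ⟨u, rfl⟩ := e.surjective v
  have hleft : inner ℂ (e u) (compress (LinearMap.range L) A (e x)) =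
      inner ℂ (L u) (A (L x)) := by
    simp [compress, e]
  simp only [LinearMap.comp_apply, LinearEquiv.coe_coe, LinearEquiv.symm_apply_apply]
  exact hleft.trans (h u x)

/-- The orthogonal complement of `V` in `W`, written `W ⊖ V` in the literature when `V ≤ W`. -/
def orthogonalIn (V W : FinSubspace E) : FinSubspace E :=
  ⟨W.1 ⊓ V.1ᗮ, Submodule.finiteDimensional_inf_left _ _⟩

lemma isOrtho_orthogonalIn (V W : FinSubspace E) : V.1 ⟂ (orthogonalIn V W).1 :=
  (Submodule.isOrtho_orthogonal_right V.1).mono_right inf_le_right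

lemma sup_orthogonalIn {V W : FinSubspace E} (h : V ≤ W) :
    V.1 ⊔ (orthogonalIn V W).1 = W.1 := by
  have h' : V.1 ≤ W.1 := h
  rw [← Submodule.sup_orthogonal_inf_of_hasOrthogonalProjection h', inf_comm]
  rfl

lemma detCompress_of_fixes {V W : FinSubspace E} (h : V ≤ W) {A : E →L[ℂ] E}
    (hA : ∀ x ∈ V.1, A x = x) : detCompress A W = detCompress A (orthogonalIn V W) := by
  rw [detCompress_sup (sup_orthogonalIn h).symm (isOrtho_orthogonalIn V W), detCompress_eq_one hA,
    one_mul]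
  intro x hx y hy
  rw [hA x hx]
  exact Submodule.isOrtho_iff_inner_eq.mp (isOrtho_orthogonalIn V W).symm y hy x hx

lemma detCompress_of_fixes_orthogonalIn {V W : FinSubspace E} (h : V ≤ W) {A : E →L[ℂ] E}
    (hA : ∀ x ∈ (orthogonalIn V W).1, A x = x) : detCompress A W = detCompress A V := by
  rw [detCompress_sup ((sup_comm _ _).trans (sup_orthogonalIn h)).symm
    (isOrtho_orthogonalIn V W).symm, detCompress_eq_one hA, one_mul]
  intro x hx y hy
  rw [hA x hx]
  exact Submodule.isOrtho_iff_inner_eq.mp (isOrtho_orthogonalIn V W) y hy x hx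

lemma detCompress_one_sub_starProjection_conj (A : E →L[ℂ] E) {V W : FinSubspace E} (h : V ≤ W) :
    detCompress (1 - V.1.starProjection ∘L A ∘L V.1.starProjection) W =
      detCompress (1 - A) V := by
  rw [detCompress_of_fixes_orthogonalIn h]
  · refine detCompress_congr fun x hx y hy => ?_
    simp [Submodule.starProjection_eq_self_iff.mpr hx,
      ← Submodule.inner_starProjection_left_eq_right, Submodule.starProjection_eq_self_iff.mpr hy]
  · intro x hx
    simp [(Submodule.starProjection_apply_eq_zero_iff V.1).mpr hx.2]

/-- Jacobi's identity for complementary minors. -/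
lemma detCompress_one_sub_mul_detCompress_inverse {A X : E →L[ℂ] E} (hX : (1 - A) ∘L X = 1)
    {V W : FinSubspace E} (h : V ≤ W) (hXW : ∀ x ∈ V.1, X x ∈ W.1) :
    detCompress (1 - A) W * detCompress X V =
      detCompress (1 - V.1ᗮ.starProjection ∘L A ∘L V.1ᗮ.starProjection) W := by
  obtain ⟨P, hP_def⟩ : ∃ P, P = V.1.starProjection := ⟨_, rfl⟩
  obtain ⟨Q, hQ_def⟩ : ∃ Q, Q = V.1ᗮ.starProjection := ⟨_, rfl⟩
  have hPQ : ∀ x, P x + Q x = x := fun x => by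
    rw [hP_def, hQ_def, V.1.starProjection_add_starProjection_orthogonal]
  have hQ : ∀ x ∈ V.1, Q x = 0 := fun x hx => by
    rw [hQ_def]
    exact (Submodule.starProjection_apply_eq_zero_iff _).mpr (V.1.le_orthogonal_orthogonal hx)
  have hQ' : ∀ x ∈ (orthogonalIn V W).1, Q x = x := fun x hx => by
    rw [hQ_def]
    exact Submodule.starProjection_eq_self_iff.mpr hx.2
  have hQ_symm : ∀ x y, inner ℂ x (Q y) = inner ℂ (Q x) y := fun x y => by
    rw [hQ_def, Submodule.inner_starProjection_left_eq_right]
  have hP : ∀ x ∈ V.1, P x = x := fun x hx => by simpa [hQ x hx] using hPQ x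
  have hP' : ∀ x ∈ (orthogonalIn V W).1, P x = 0 := fun x hx => by simpa [hQ' x hx] using hPQ x
  have hfactor : (1 - A) ∘L (X ∘L P + Q) = 1 - A ∘L Q := by
    ext x
    have hXP : X (P x) - A (X (P x)) = P x := congrArg (fun B : E →L[ℂ] E => B (P x)) hX
    calc X (P x) + Q x - A (X (P x) + Q x)
        = (X (P x) - A (X (P x))) + Q x - A (Q x) := by rw [map_add]; abel
      _ = x - A (Q x) := by rw [hXP, hPQ]
  have hmaps : ∀ x ∈ W.1, (X ∘L P + Q) x ∈ W.1 := fun x hx => by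
    have hPx : P x ∈ V.1 := hP_def ▸ Submodule.starProjection_apply_mem _ _
    have hQx : Q x = x - P x := eq_sub_of_add_eq' (hPQ x)
    exact W.1.add_mem (hXW _ hPx) (hQx ▸ W.1.sub_mem hx (h hPx))
  have hX_eq : detCompress X V = detCompress (X ∘L P + Q) W := by
    rw [detCompress_of_fixes_orthogonalIn h fun x hx => by simp [hP' x hx, hQ' x hx]]
    exact detCompress_congr fun x hx y _ => by simp [hP x hx, hQ x hx]
  rw [← hQ_def]
  calc detCompress (1 - A) W * detCompress X V
      = detCompress (1 - A ∘L Q) W := by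
        rw [hX_eq, ← detCompress_comp_of_mapsTo _ hmaps, hfactor]
    _ = detCompress (1 - A ∘L Q) (orthogonalIn V W) :=
        detCompress_of_fixes h fun x hx => by simp [hQ x hx]
    _ = detCompress (1 - Q ∘L A ∘L Q) (orthogonalIn V W) :=
        detCompress_congr fun x _ y hy => by simp [hQ_symm, hQ' y hy]
    _ = detCompress (1 - Q ∘L A ∘L Q) W :=
        (detCompress_of_fixes h fun x hx => by simp [hQ x hx]).symm

end DetCompress

/-! ### Trace norm estimates and Fredholm determinants -/

section TraceNorm

variable {E : Type*} [NormedAddCommGroup E] [InnerProductSpace ℂ E]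

/-- The trace norm of `A` is at most `C`, in the sense of `IsTraceClass`. -/
def TraceNormLE (A : E →L[ℂ] E) (C : ℝ) : Prop :=
  ∀ (n : ℕ) (e f : Fin n → E), Orthonormal ℂ e → Orthonormal ℂ f →
    ∑ i, ‖inner ℂ (e i) (A (f i))‖ ≤ C

lemma TraceNormLE.mono {A : E →L[ℂ] E} {C D : ℝ} (h : TraceNormLE A C) (hCD : C ≤ D) :
    TraceNormLE A D :=
  fun n e f he hf => (h n e f he hf).trans hCD

lemma TraceNormLE.add {A B : E →L[ℂ] E} {C D : ℝ} (hA : TraceNormLE A C)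
    (hB : TraceNormLE B D) : TraceNormLE (A + B) (C + D) := by
  intro n e f he hf
  refine le_trans ?_ (add_le_add (hA n e f he hf) (hB n e f he hf))
  rw [← Finset.sum_add_distrib]
  gcongr
  rw [add_apply, inner_add_right]
  exact norm_add_le _ _

lemma TraceNormLE.smul {A : E →L[ℂ] E} {C : ℝ} (hA : TraceNormLE A C) (z : ℂ) :
    TraceNormLE (z • A) (‖z‖ * C) := fun n e f he hf => by
  simpa [inner_smul_right, Finset.mul_sum] using
    mul_le_mul_of_nonneg_left (hA n e f he hf) (norm_nonneg z)

lemma TraceNormLE.compress {A : E →L[ℂ] E} {C : ℝ} (h : TraceNormLE A C) (V : Submodule ℂ E)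
    [V.HasOrthogonalProjection] : TraceNormLE (compress V A) C := fun n e f he hf => by
  simpa [ModelSpace.compress] using h n (fun i => e i) (fun i => f i)
    (he.comp_linearIsometry V.subtypeₗᵢ) (hf.comp_linearIsometry V.subtypeₗᵢ)

lemma exists_norm_det_eq_prod_norm_inner [FiniteDimensional ℂ E] (M : E →ₗ[ℂ] E) :
    ∃ e f : Fin (Module.finrank ℂ E) → E, Orthonormal ℂ e ∧ Orthonormal ℂ f ∧
      ‖LinearMap.det M‖ = ∏ i, ‖inner ℂ (e i) (M (f i))‖ := by
  set f := stdOrthonormalBasis ℂ E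
  have hcard : Module.finrank ℂ E = Fintype.card (Fin (Module.finrank ℂ E)) := by simp
  set e := InnerProductSpace.gramSchmidtOrthonormalBasis hcard (fun i => M (f i))
  have htriangular : e.toBasis.det (M ∘ f) = ∏ i, inner ℂ (e i) (M (f i)) :=
    InnerProductSpace.gramSchmidtOrthonormalBasis_det hcard _
  have hchange : ‖e.toBasis.det f‖ = 1 := e.det_to_matrix_orthonormalBasis f
  refine ⟨e, f, e.orthonormal, f.orthonormal, ?_⟩
  rw [← norm_prod, ← htriangular, e.toBasis.det_comp, norm_mul, hchange, mul_one]

lemma norm_det_one_sub_le [FiniteDimensional ℂ E] {A : E →L[ℂ] E} {C : ℝ}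
    (hA : TraceNormLE A C) :
    ‖LinearMap.det ((1 - A : E →L[ℂ] E) : E →ₗ[ℂ] E)‖ ≤ Real.exp C := by
  obtain ⟨e, f, he, hf, hdet⟩ :=
    exists_norm_det_eq_prod_norm_inner ((1 - A : E →L[ℂ] E) : E →ₗ[ℂ] E)
  have hentry : ∀ i, ‖inner ℂ (e i) ((1 - A) (f i))‖ ≤ Real.exp ‖inner ℂ (e i) (A (f i))‖ := by
    intro i
    have hle : ‖inner ℂ (e i) (f i)‖ ≤ 1 := by
      simpa [he.1 i, hf.1 i] using norm_inner_le_norm (𝕜 := ℂ) (e i) (f i)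
    calc ‖inner ℂ (e i) ((1 - A) (f i))‖
        ≤ ‖inner ℂ (e i) (f i)‖ + ‖inner ℂ (e i) (A (f i))‖ := by
          rw [sub_apply, inner_sub_right]
          exact norm_sub_le _ _
      _ ≤ ‖inner ℂ (e i) (A (f i))‖ + 1 := by linarith
      _ ≤ _ := Real.add_one_le_exp _
  calc _ = ∏ i, ‖inner ℂ (e i) ((1 - A) (f i))‖ := hdet
    _ ≤ ∏ i, Real.exp ‖inner ℂ (e i) (A (f i))‖ :=
        Finset.prod_le_prod (fun i _ => norm_nonneg _) fun i _ => hentry i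
    _ = Real.exp (∑ i, ‖inner ℂ (e i) (A (f i))‖) := (Real.exp_sum _ _).symm
    _ ≤ Real.exp C := Real.exp_le_exp.mpr (hA _ _ _ he hf)

lemma differentiable_det_add_smul [FiniteDimensional ℂ E] (A B : E →ₗ[ℂ] E) :
    Differentiable ℂ fun z : ℂ => LinearMap.det (A + z • B) := by
  simp only [← LinearMap.det_toMatrix (Module.finBasis ℂ E), map_add, map_smul, Matrix.det_apply,
    Matrix.add_apply, Matrix.smul_apply]
  fun_prop

lemma norm_det_sub_det_le [FiniteDimensional ℂ E] {A B : E →L[ℂ] E} {C ε : ℝ} (hε : 0 < ε)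
    (hε1 : ε < 1) (hA : TraceNormLE A C) (hB : TraceNormLE (B - A) ε) :
    ‖LinearMap.det ((1 - B : E →L[ℂ] E) : E →ₗ[ℂ] E) -
      LinearMap.det ((1 - A : E →L[ℂ] E) : E →ₗ[ℂ] E)‖ ≤ 2 * Real.exp (C + 1) * ε := by
  -- Schwarz's lemma on the disk `‖z‖ < 1 / ε`, where the determinant stays bounded by `exp (C + 1)`
  set g : ℂ → ℂ := fun z => LinearMap.det ((1 - (A + z • (B - A)) : E →L[ℂ] E) : E →ₗ[ℂ] E)
  have hg : Differentiable ℂ g := by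
    convert! differentiable_det_add_smul (E := E) ((1 - A : E →L[ℂ] E) : E →ₗ[ℂ] E)
      ((A - B : E →L[ℂ] E) : E →ₗ[ℂ] E) using 3 with z
    ext x
    simp only [smul_sub, ContinuousLinearMap.toLinearMap_sub,
      ContinuousLinearMap.toLinearMap_one, ContinuousLinearMap.toLinearMap_add,
      ContinuousLinearMap.toLinearMap_smul, LinearMap.sub_apply, Module.End.one_apply,
      LinearMap.add_apply, ContinuousLinearMap.coe_coe, LinearMap.smul_apply]
    abel
  have hbound : ∀ z : ℂ, ‖z‖ * ε < 1 → ‖g z‖ ≤ Real.exp (C + 1) := fun z hz =>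
    norm_det_one_sub_le ((hA.add (hB.smul z)).mono (by linarith))
  have hmaps : Set.MapsTo g (Metric.ball 0 (1 / ε))
      (Metric.closedBall (g 0) (2 * Real.exp (C + 1))) := by
    intro z hz
    rw [mem_ball_zero_iff, lt_div_iff₀ hε] at hz
    rw [mem_closedBall_iff_norm, two_mul]
    exact (norm_sub_le _ _).trans (add_le_add (hbound z hz) (hbound 0 (by simp)))
  have hmem : (1 : ℂ) ∈ Metric.ball (0 : ℂ) (1 / ε) := by
    rwa [mem_ball_zero_iff, norm_one, lt_div_iff₀ hε, one_mul]
  simpa [g, dist_eq_norm] using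
    Complex.dist_le_div_mul_dist_of_mapsTo_ball hg.differentiableOn hmaps hmem

lemma norm_detCompress_sub_le {A B : E →L[ℂ] E} {C ε : ℝ} (hε : 0 < ε) (hε1 : ε < 1)
    (hA : TraceNormLE A C) (hB : TraceNormLE (B - A) ε) (V : FinSubspace E) :
    ‖detCompress (1 - B) V - detCompress (1 - A) V‖ ≤ 2 * Real.exp (C + 1) * ε := by
  have h := norm_det_sub_det_le hε hε1 (hA.compress V.1)
    (by simpa only [compress_sub] using hB.compress V.1)
  simpa only [detCompress, compress_sub, compress_one] using h

lemma exists_pos_lt_one_mul_lt {ε : ℝ} (hε : 0 < ε) (K : ℝ) :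
    ∃ δ : ℝ, 0 < δ ∧ δ < 1 ∧ K * δ < ε := by
  obtain ⟨δ, hδ, h⟩ := exists_pos_mul_lt hε (max K ε)
  have hK := mul_le_mul_of_nonneg_right (le_max_left K ε) hδ.le
  have hε' := mul_le_mul_of_nonneg_right (le_max_right K ε) hδ.le
  exact ⟨δ, hδ, by nlinarith, by linarith⟩

lemma IsDetOneSub.tendsto {J : Type*} {l : Filter J} {A : J → E →L[ℂ] E} {A₀ : E →L[ℂ] E}
    {d : J → ℂ} {d₀ : ℂ} (hd : ∀ j, IsDetOneSub (A j) (d j)) (hd₀ : IsDetOneSub A₀ d₀)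
    (h : ∀ ε > 0, ∀ᶠ j in l, TraceNormLE (A j - A₀) ε) : Tendsto d l (𝓝 d₀) := by
  obtain ⟨C, hC⟩ := hd₀.1
  rw [Metric.tendsto_nhds]
  intro ε hε
  obtain ⟨δ, hδ, hδ1, hδε⟩ := exists_pos_lt_one_mul_lt hε (2 * Real.exp (C + 1))
  filter_upwards [h δ hδ] with j hj
  rw [dist_eq_norm]
  exact (le_of_tendsto' ((hd j).2.sub hd₀.2).norm
    (norm_detCompress_sub_le hδ hδ1 hC hj)).trans_lt hδε

lemma exists_isDetOneSub_of_compress_approx {A : E →L[ℂ] E} (hA : IsTraceClass A)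
    (h : ∀ ε > 0, ∃ V : FinSubspace E,
      TraceNormLE (V.1.starProjection ∘L A ∘L V.1.starProjection - A) ε) :
    ∃ d, IsDetOneSub A d := by
  obtain ⟨C, hC⟩ := id hA
  suffices hcauchy : Cauchy (map (detCompress (1 - A)) atTop) by
    obtain ⟨d, hd⟩ := cauchy_map_iff_exists_tendsto.mp hcauchy
    exact ⟨d, hA, hd⟩
  refine Metric.cauchy_iff.mpr ⟨inferInstance, fun ε hε => ?_⟩
  obtain ⟨δ, hδ, hδ1, hδε⟩ := exists_pos_lt_one_mul_lt (half_pos hε) (2 * Real.exp (C + 1))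
  obtain ⟨V, hV⟩ := h δ hδ
  have hdist : ∀ W ≥ V, dist (detCompress (1 - A) V) (detCompress (1 - A) W) < ε / 2 := by
    intro W hW
    rw [← detCompress_one_sub_starProjection_conj _ hW, dist_eq_norm]
    exact (norm_detCompress_sub_le hδ hδ1 hC hV W).trans_lt hδε
  refine ⟨detCompress (1 - A) '' Set.Ici V, image_mem_map (Ici_mem_atTop V), ?_⟩
  rintro _ ⟨W, hW, rfl⟩ _ ⟨W', hW', rfl⟩
  linarith [hdist W hW, hdist W' hW', dist_triangle_left (detCompress (1 - A) W)
    (detCompress (1 - A) W') (detCompress (1 - A) V)]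

lemma isDetOneSub_zero : IsDetOneSub (0 : E →L[ℂ] E) 1 :=
  ⟨⟨0, fun n e f _ _ => by simp⟩,
    tendsto_const_nhds.congr fun V => (detCompress_eq_one fun x _ => by simp).symm⟩

lemma IsDetOneSub.mul_detCompress_inverse {A X : E →L[ℂ] E} (hX : (1 - A) ∘L X = 1)
    (V : FinSubspace E) {d d' : ℂ} (hd : IsDetOneSub A d)
    (hd' : IsDetOneSub (V.1ᗮ.starProjection ∘L A ∘L V.1ᗮ.starProjection) d') :
    d * detCompress X V = d' := by
  refine tendsto_nhds_unique (hd.2.mul_const (detCompress X V)) (hd'.2.congr' ?_)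
  filter_upwards [Ici_mem_atTop (⟨V.1 ⊔ V.1.map (X : E →ₗ[ℂ] E), inferInstance⟩ : FinSubspace E)]
    with W hW
  have hW : V.1 ⊔ V.1.map (X : E →ₗ[ℂ] E) ≤ W.1 := hW
  exact (detCompress_one_sub_mul_detCompress_inverse hX (le_sup_left.trans hW)
    fun x hx => hW (Submodule.mem_sup_right ⟨x, hx, rfl⟩)).symm

end TraceNorm

section HilbertSchmidt

variable {E F ι : Type*} [NormedAddCommGroup E] [InnerProductSpace ℂ E]
  [NormedAddCommGroup F] [InnerProductSpace ℂ F] (b : HilbertBasis ι ℂ F)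

/-- `S` is a Hilbert–Schmidt operator; the notion does not depend on the Hilbert basis `b`. -/
def IsHilbertSchmidt (S : F →L[ℂ] E) : Prop := Summable fun k => ‖S (b k)‖ ^ 2

/-- The Hilbert–Schmidt norm; it has the junk value `0` unless `IsHilbertSchmidt b S`. -/
def hilbertSchmidtNorm (S : F →L[ℂ] E) : ℝ := √(∑' k, ‖S (b k)‖ ^ 2)

variable {b}

lemma IsHilbertSchmidt.sub {S T : F →L[ℂ] E} (hS : IsHilbertSchmidt b S)
    (hT : IsHilbertSchmidt b T) : IsHilbertSchmidt b (S - T) := by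
  refine Summable.of_nonneg_of_le (fun k => by positivity) (fun k => ?_)
    ((hS.add hT).mul_left 2)
  calc ‖(S - T) (b k)‖ ^ 2 ≤ (‖S (b k)‖ + ‖T (b k)‖) ^ 2 := by
        gcongr
        exact norm_sub_le _ _
    _ ≤ 2 * (‖S (b k)‖ ^ 2 + ‖T (b k)‖ ^ 2) := add_sq_le

lemma IsHilbertSchmidt.comp_left {S : F →L[ℂ] E} (hS : IsHilbertSchmidt b S) (N : E →L[ℂ] E) :
    IsHilbertSchmidt b (N ∘L S) := by
  refine Summable.of_nonneg_of_le (fun k => by positivity) (fun k => ?_) (hS.mul_left (‖N‖ ^ 2))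
  rw [← mul_pow]
  gcongr
  exact N.le_opNorm _

lemma tendsto_hilbertSchmidtNorm_comp_sub {J : Type*} {l : Filter J} {M : J → E →L[ℂ] E}
    {N : E →L[ℂ] E} {C : ℝ} {S : F →L[ℂ] E} (hS : IsHilbertSchmidt b S)
    (hM : ∀ x, Tendsto (fun j => M j x) l (𝓝 (N x))) (hC : ∀ j, ‖M j‖ ≤ C) :
    Tendsto (fun j => hilbertSchmidtNorm b (M j ∘L S - N ∘L S)) l (𝓝 0) := by
  suffices h : Tendsto (fun j => ∑' k, ‖(M j ∘L S - N ∘L S) (b k)‖ ^ 2) l (𝓝 0) by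
    simpa only [hilbertSchmidtNorm, Real.sqrt_zero] using h.sqrt
  rw [← tsum_zero (α := ℝ) (β := ι)]
  refine tendsto_tsum_of_dominated_convergence (bound := fun k => (C + ‖N‖) ^ 2 * ‖S (b k)‖ ^ 2)
    (hS.mul_left _) (fun k => ?_) (Eventually.of_forall fun j k => ?_)
  · simpa using ((hM (S (b k))).sub_const (N (S (b k)))).norm.pow 2
  · rw [Real.norm_of_nonneg (by positivity), ← mul_pow]
    gcongr
    calc ‖(M j - N) (S (b k))‖ ≤ ‖M j - N‖ * ‖S (b k)‖ := (M j - N).le_opNorm _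
      _ ≤ (C + ‖N‖) * ‖S (b k)‖ := by
        gcongr
        exact (norm_sub_le _ _).trans (add_le_add_left (hC j) _)

variable (b) in
lemma hasSum_norm_inner_sq (x : F) : HasSum (fun k => ‖inner ℂ (b k) x‖ ^ 2) (‖x‖ ^ 2) := by
  simpa [b.repr_apply_apply] using lp.hasSum_norm (p := 2) (by simp) (b.repr x)

variable [CompleteSpace E] [CompleteSpace F]

lemma IsHilbertSchmidt.sum_norm_adjoint_sq_le {T : F →L[ℂ] E} (hT : IsHilbertSchmidt b T)
    {n : ℕ} {e : Fin n → E} (he : Orthonormal ℂ e) :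
    ∑ i, ‖ContinuousLinearMap.adjoint T (e i)‖ ^ 2 ≤ ∑' k, ‖T (b k)‖ ^ 2 := by
  refine hasSum_le (fun k => ?_) (hasSum_sum fun i _ =>
    hasSum_norm_inner_sq b (ContinuousLinearMap.adjoint T (e i))) hT.hasSum
  simpa only [ContinuousLinearMap.adjoint_inner_right, norm_inner_symm (T (b k))] using
    he.sum_inner_products_le (T (b k)) (s := Finset.univ)

lemma IsHilbertSchmidt.traceNormLE_comp_adjoint {S T : F →L[ℂ] E} (hS : IsHilbertSchmidt b S)
    (hT : IsHilbertSchmidt b T) :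
    TraceNormLE (S ∘L ContinuousLinearMap.adjoint T)
      (hilbertSchmidtNorm b S * hilbertSchmidtNorm b T) := by
  intro n e f he hf
  calc ∑ i, ‖inner ℂ (e i) (S (ContinuousLinearMap.adjoint T (f i)))‖
      ≤ ∑ i, ‖ContinuousLinearMap.adjoint S (e i)‖ * ‖ContinuousLinearMap.adjoint T (f i)‖ := by
        gcongr
        rw [← ContinuousLinearMap.adjoint_inner_left]
        exact norm_inner_le_norm _ _
    _ ≤ √(∑ i, ‖ContinuousLinearMap.adjoint S (e i)‖ ^ 2) *
          √(∑ i, ‖ContinuousLinearMap.adjoint T (f i)‖ ^ 2) := Real.sum_mul_le_sqrt_mul_sqrt _ _ _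
    _ ≤ hilbertSchmidtNorm b S * hilbertSchmidtNorm b T := by
        unfold hilbertSchmidtNorm
        gcongr
        · exact hS.sum_norm_adjoint_sq_le he
        · exact hT.sum_norm_adjoint_sq_le hf

lemma eventually_traceNormLE_comp_adjoint_sub {J : Type*} {l : Filter J} {S T : J → F →L[ℂ] E}
    {S₀ T₀ : F →L[ℂ] E} (hS : ∀ j, IsHilbertSchmidt b (S j)) (hT : ∀ j, IsHilbertSchmidt b (T j))
    (hS₀ : IsHilbertSchmidt b S₀) (hT₀ : IsHilbertSchmidt b T₀)
    (hSlim : Tendsto (fun j => hilbertSchmidtNorm b (S j - S₀)) l (𝓝 0))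
    (hTlim : Tendsto (fun j => hilbertSchmidtNorm b (T j - T₀)) l (𝓝 0)) {ε : ℝ} (hε : 0 < ε) :
    ∀ᶠ j in l, TraceNormLE (S j ∘L ContinuousLinearMap.adjoint (T j) -
      S₀ ∘L ContinuousLinearMap.adjoint T₀) ε := by
  have hlim := ((hSlim.mul_const (hilbertSchmidtNorm b T₀)).add (hSlim.mul hTlim)).add
    (hTlim.const_mul (hilbertSchmidtNorm b S₀))
  simp only [zero_mul, mul_zero, add_zero] at hlim
  filter_upwards [hlim.eventually_le_const hε] with j hj
  have hsplit : S j ∘L ContinuousLinearMap.adjoint (T j) - S₀ ∘L ContinuousLinearMap.adjoint T₀ =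
      (S j - S₀) ∘L ContinuousLinearMap.adjoint T₀ +
        (S j - S₀) ∘L ContinuousLinearMap.adjoint (T j - T₀) +
        S₀ ∘L ContinuousLinearMap.adjoint (T j - T₀) := by
    ext x
    simp
  rw [hsplit]
  have hS' := (hS j).sub hS₀
  have hT' := (hT j).sub hT₀
  exact (((hS'.traceNormLE_comp_adjoint hT₀).add (hS'.traceNormLE_comp_adjoint hT')).add
    (hS₀.traceNormLE_comp_adjoint hT')).mono hj

lemma conj_comp_adjoint {N : E →L[ℂ] E} (hN : IsSelfAdjoint N) (S T : F →L[ℂ] E) :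
    N ∘L (S ∘L ContinuousLinearMap.adjoint T) ∘L N =
      (N ∘L S) ∘L ContinuousLinearMap.adjoint (N ∘L T) := by
  rw [ContinuousLinearMap.adjoint_comp, hN.adjoint_eq]
  rfl

variable {S T : F →L[ℂ] E}

lemma eventually_traceNormLE_conj_sub (hS : IsHilbertSchmidt b S) (hT : IsHilbertSchmidt b T)
    {J : Type*} {l : Filter J} {M : J → E →L[ℂ] E} {N : E →L[ℂ] E} {C : ℝ}
    (hM : ∀ x, Tendsto (fun j => M j x) l (𝓝 (N x))) (hC : ∀ j, ‖M j‖ ≤ C)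
    (hM_sa : ∀ j, IsSelfAdjoint (M j)) (hN_sa : IsSelfAdjoint N) {ε : ℝ} (hε : 0 < ε) :
    ∀ᶠ j in l, TraceNormLE (M j ∘L (S ∘L ContinuousLinearMap.adjoint T) ∘L M j -
      N ∘L (S ∘L ContinuousLinearMap.adjoint T) ∘L N) ε := by
  simp only [conj_comp_adjoint (hM_sa _), conj_comp_adjoint hN_sa]
  exact eventually_traceNormLE_comp_adjoint_sub (fun j => hS.comp_left _) (fun j => hT.comp_left _)
    (hS.comp_left _) (hT.comp_left _) (tendsto_hilbertSchmidtNorm_comp_sub hS hM hC)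
    (tendsto_hilbertSchmidtNorm_comp_sub hT hM hC) hε

lemma exists_isDetOneSub_comp_adjoint (hS : IsHilbertSchmidt b S) (hT : IsHilbertSchmidt b T) :
    ∃ d, IsDetOneSub (S ∘L ContinuousLinearMap.adjoint T) d := by
  refine exists_isDetOneSub_of_compress_approx ⟨_, hS.traceNormLE_comp_adjoint hT⟩ fun ε hε => ?_
  exact (eventually_traceNormLE_conj_sub hS hT (N := 1) tendsto_starProjection_finSubspace
    (fun V => V.1.starProjection_norm_le) (fun V => isSelfAdjoint_starProjection V.1)
    (IsSelfAdjoint.one _) hε).exists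

lemma exists_isDetOneSub_conj (hS : IsHilbertSchmidt b S) (hT : IsHilbertSchmidt b T)
    {N : E →L[ℂ] E} (hN : IsSelfAdjoint N) :
    ∃ d, IsDetOneSub (N ∘L (S ∘L ContinuousLinearMap.adjoint T) ∘L N) d := by
  rw [conj_comp_adjoint hN]
  exact exists_isDetOneSub_comp_adjoint (hS.comp_left N) (hT.comp_left N)

/-- The compressions of `S T†` to `Vᗮ` tend to `0` in trace norm as `V` increases, so their
determinants tend to `1`, and by Jacobi's identity `d` divides each of them. -/
lemma det_ne_zero_of_rightInverse (hS : IsHilbertSchmidt b S) (hT : IsHilbertSchmidt b T)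
    {X : E →L[ℂ] E} (hX : (1 - S ∘L ContinuousLinearMap.adjoint T) ∘L X = 1) {d : ℂ}
    (hd : IsDetOneSub (S ∘L ContinuousLinearMap.adjoint T) d) : d ≠ 0 := by
  rintro rfl
  have hzero : ∀ V : FinSubspace E, IsDetOneSub
      (V.1ᗮ.starProjection ∘L (S ∘L ContinuousLinearMap.adjoint T) ∘L V.1ᗮ.starProjection) 0 := by
    intro V
    obtain ⟨d', hd'⟩ := exists_isDetOneSub_conj hS hT (isSelfAdjoint_starProjection V.1ᗮ)
    rwa [← hd.mul_detCompress_inverse hX V hd', zero_mul] at hd'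
  have hstrong : ∀ x, Tendsto (fun V : FinSubspace E => V.1ᗮ.starProjection x) atTop
      (𝓝 ((0 : E →L[ℂ] E) x)) := fun x => by
    simpa [Submodule.starProjection_orthogonal] using
      (tendsto_starProjection_finSubspace x).const_sub x
  have hlim : Tendsto (fun _ : FinSubspace E => (0 : ℂ)) atTop (𝓝 1) :=
    IsDetOneSub.tendsto hzero isDetOneSub_zero fun ε hε => by
      simpa using eventually_traceNormLE_conj_sub hS hT hstrong
        (fun V => V.1ᗮ.starProjection_norm_le) (fun V => isSelfAdjoint_starProjection V.1ᗮ)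
        (IsSelfAdjoint.zero _) hε
  exact zero_ne_one (tendsto_nhds_unique tendsto_const_nhds hlim)

end HilbertSchmidt

/-! ### Fourier coefficients and multiplication operators on `L²` -/

section L2

variable {m : ℕ}

lemma coeffCLM_apply (n : ℤ) (f : L2 m) :
    coeffCLM m n f = fourierCoeff (f : Angle → Vec m) n := rfl

lemma integrable_coe (f : L2 m) : Integrable (f : Angle → Vec m) σ :=
  (Lp.memLp f).integrable (by norm_num)

lemma norm_coeffCLM_le (n : ℤ) (f : L2 m) : ‖coeffCLM m n f‖ ≤ ‖f‖ := by
  simpa using (coeffCLM m n).le_of_opNorm_le (LinearMap.mkContinuous_norm_le _ zero_le_one _) f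

/-- The monomial `tⁿ x`. -/
def monomial (n : ℤ) (x : Vec m) : L2 m :=
  ContinuousMap.toLp 2 σ ℂ ⟨fun θ : Angle => (fourier n θ : ℂ) • x, by fun_prop⟩

lemma coeFn_monomial (n : ℤ) (x : Vec m) :
    (monomial n x : Angle → Vec m) =ᵐ[σ] fun θ => (fourier n θ : ℂ) • x :=
  ContinuousMap.coeFn_toLp _ _

lemma inner_monomial_left (n : ℤ) (x : Vec m) (f : L2 m) :
    inner ℂ (monomial n x) f = inner ℂ x (coeffCLM m n f) := by
  rw [L2.inner_def, coeffCLM_apply, fourierCoeff,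
    ← integral_inner ((integrable_coe f).fourier_smul (-n))]
  refine integral_congr_ae ?_
  filter_upwards [coeFn_monomial n x] with θ hθ
  rw [hθ, inner_smul_left, inner_smul_right, ← fourier_neg]

lemma coeffCLM_monomial (k n : ℤ) (x : Vec m) :
    coeffCLM m k (monomial n x) = if k = n then x else 0 := by
  have hpull : fourierCoeff (T := 2 * Real.pi) (fun θ => (fourier n θ : ℂ) • x) k =
      fourierCoeff (T := 2 * Real.pi) (fourier n) k • x := by
    simp only [fourierCoeff, smul_smul, integral_smul_const, smul_eq_mul]
  rw [coeffCLM_apply, fourierCoeff_congr_ae (coeFn_monomial n x), hpull, fourierCoeff_fourier,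
    Pi.single_apply]
  split_ifs <;> simp

lemma compLp_proj_eq_zero {u : L2 m} (h : ∀ n, coeffCLM m n u = 0) (i : Fin m) :
    (EuclideanSpace.proj i : Vec m →L[ℂ] ℂ).compLp u = 0 := by
  apply (fourierBasis (T := 2 * Real.pi)).repr.injective
  ext n
  have hi := congrArg (EuclideanSpace.proj i : Vec m →L[ℂ] ℂ) (h n)
  rw [coeffCLM_apply, fourierCoeff, ← ContinuousLinearMap.integral_comp_comm _
    ((integrable_coe u).fourier_smul (-n)), map_zero] at hi
  rw [fourierBasis_repr, map_zero, lp.coeFn_zero, Pi.zero_apply,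
    fourierCoeff_congr_ae (ContinuousLinearMap.coeFn_compLp _ u), ← hi, fourierCoeff]
  simp only [map_smul]

lemma ext_coeffCLM {f g : L2 m} (h : ∀ n, coeffCLM m n f = coeffCLM m n g) : f = g := by
  rw [← sub_eq_zero, Lp.eq_zero_iff_ae_eq_zero]
  have hcomp : ∀ i : Fin m, ∀ᵐ θ ∂σ, (f - g) θ i = 0 := fun i => by
    have hi := compLp_proj_eq_zero (u := f - g) (fun n => by rw [map_sub, h, sub_self]) i
    filter_upwards [Lp.eq_zero_iff_ae_eq_zero.mp hi,
      (EuclideanSpace.proj i : Vec m →L[ℂ] ℂ).coeFn_compLp (f - g)] with θ hzero hcoe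
    exact hcoe.symm.trans hzero
  filter_upwards [ae_all_iff.mpr hcomp] with θ hθ
  ext i
  exact hθ i

/-- The orthonormal basis of `L²` formed by the functions `tⁿ e_i`. -/
def monomialBasis (m : ℕ) : HilbertBasis (ℤ × Fin m) ℂ (L2 m) :=
  HilbertBasis.mkOfOrthogonalEqBot
    (v := fun p : ℤ × Fin m => monomial p.1 (EuclideanSpace.single p.2 (1 : ℂ)))
    (by
      rw [orthonormal_iff_ite]
      rintro ⟨n, i⟩ ⟨k, j⟩
      rw [inner_monomial_left, coeffCLM_monomial]
      by_cases hnk : n = k <;> by_cases hij : i = j <;>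
        simp [hnk, hij, EuclideanSpace.inner_single_left])
    (by
      refine (Submodule.eq_bot_iff _).mpr fun f hf => ext_coeffCLM fun n => ?_
      ext i
      have hi := (Submodule.mem_orthogonal _ _).mp hf _ (Submodule.subset_span ⟨(n, i), rfl⟩)
      simpa [inner_monomial_left, EuclideanSpace.inner_single_left] using hi)

lemma monomialBasis_apply (p : ℤ × Fin m) :
    monomialBasis m p = monomial p.1 (EuclideanSpace.single p.2 (1 : ℂ)) := by
  rw [monomialBasis, HilbertBasis.coe_mkOfOrthogonalEqBot]

lemma mem_H2_iff_coeffCLM {f : L2 m} : f ∈ H2 m ↔ ∀ n : ℤ, n < 0 → coeffCLM m n f = 0 := mem_H2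

lemma monomial_mem_H2 {n : ℤ} (hn : 0 ≤ n) (x : Vec m) : monomial n x ∈ H2 m :=
  mem_H2_iff_coeffCLM.mpr fun k hk => by rw [coeffCLM_monomial, if_neg (by omega)]

lemma coeffCLM_of_mem_H2_orthogonal {f : L2 m} (hf : f ∈ (H2 m)ᗮ) {n : ℤ} (hn : 0 ≤ n) :
    coeffCLM m n f = 0 := by
  refine ext_inner_left ℂ fun x => ?_
  rw [← inner_monomial_left, inner_zero_right]
  exact (Submodule.mem_orthogonal _ _).mp hf _ (monomial_mem_H2 hn x)

lemma coeffCLM_starProjection_H2 (n : ℤ) (f : L2 m) :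
    coeffCLM m n ((H2 m).starProjection f) = if 0 ≤ n then coeffCLM m n f else 0 := by
  split_ifs with hn
  · have h := coeffCLM_of_mem_H2_orthogonal ((H2 m).sub_starProjection_mem_orthogonal f) hn
    exact (sub_eq_zero.mp (map_sub (coeffCLM m n) _ _ ▸ h)).symm
  · exact mem_H2_iff_coeffCLM.mp ((H2 m).starProjection_apply_mem f) n (by omega)

lemma mem_H2_orthogonal_iff {f : L2 m} :
    f ∈ (H2 m)ᗮ ↔ ∀ n : ℤ, 0 ≤ n → coeffCLM m n f = 0 := by
  refine ⟨fun hf n hn => coeffCLM_of_mem_H2_orthogonal hf hn, fun h => ?_⟩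
  rw [← Submodule.starProjection_apply_eq_zero_iff]
  refine ext_coeffCLM fun n => ?_
  rw [coeffCLM_starProjection_H2, map_zero]
  split_ifs with hn
  exacts [h n hn, rfl]

lemma toCLM_apply (a : Symbol m) (θ : Angle) :
    a.toCLM θ = Matrix.toEuclideanCLM (n := Fin m) (𝕜 := ℂ) (a θ.toCircle) := rfl

lemma coeFn_mulOp (a : Symbol m) (f : L2 m) :
    (mulOp a f : Angle → Vec m) =ᵐ[σ] fun θ => a.toCLM θ (f θ) := by
  filter_upwards [(ContinuousLinearMap.id ℂ (Vec m →L[ℂ] Vec m)).coeFn_holder (r := 2)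
    (ContinuousMap.toLp ∞ σ ℂ a.toCLM) f,
    ContinuousMap.coeFn_toLp (p := ∞) (𝕜 := ℂ) σ a.toCLM] with θ hholder hsymbol
  rw [hsymbol] at hholder
  exact hholder

lemma mulOp_mul (a b : Symbol m) : mulOp (a * b) = mulOp a ∘L mulOp b := by
  ext1 f
  refine Lp.ext ?_
  filter_upwards [coeFn_mulOp (a * b) f, coeFn_mulOp a (mulOp b f), coeFn_mulOp b f]
    with θ hab ha hb
  rw [hab, ContinuousLinearMap.comp_apply, ha, hb]
  simp [toCLM_apply]

lemma mulOp_one : mulOp (1 : Symbol m) = 1 := by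
  ext1 f
  refine Lp.ext ?_
  filter_upwards [coeFn_mulOp 1 f] with θ h
  rw [h]
  simp [toCLM_apply]

lemma mulOp_sub (a b : Symbol m) : mulOp (a - b) = mulOp a - mulOp b := by
  ext1 f
  refine Lp.ext ?_
  filter_upwards [coeFn_mulOp (a - b) f, coeFn_mulOp a f, coeFn_mulOp b f,
    Lp.coeFn_sub (mulOp a f) (mulOp b f)] with θ hab ha hb hsub
  rw [hab, sub_apply, hsub, Pi.sub_apply, ha, hb]
  simp [toCLM_apply]

lemma mulOp_smul (c : ℂ) (a : Symbol m) : mulOp (c • a) = c • mulOp a := by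
  ext1 f
  refine Lp.ext ?_
  filter_upwards [coeFn_mulOp (c • a) f, coeFn_mulOp a f, Lp.coeFn_smul c (mulOp a f)]
    with θ hca ha hsmul
  rw [hca, smul_apply, hsmul, Pi.smul_apply, ha]
  simp [toCLM_apply]

lemma inner_mulOp_left (a : Symbol m) (f g : L2 m) :
    inner ℂ (mulOp a f) g = inner ℂ f (mulOp (star a) g) := by
  rw [L2.inner_def, L2.inner_def]
  refine integral_congr_ae ?_
  filter_upwards [coeFn_mulOp a f, coeFn_mulOp (star a) g] with θ ha hstar
  have hadj : (star a).toCLM θ = ContinuousLinearMap.adjoint (a.toCLM θ) :=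
    map_star (Matrix.toEuclideanCLM (𝕜 := ℂ)) _
  rw [ha, hstar, hadj, ContinuousLinearMap.adjoint_inner_right]

lemma adjoint_mulOp (a : Symbol m) :
    ContinuousLinearMap.adjoint (mulOp a) = mulOp (star a) := by
  rw [eq_comm, ContinuousLinearMap.eq_adjoint_iff]
  intro f g
  rw [inner_mulOp_left, star_star]

lemma toEuclideanCLM_coeff_apply (a : Symbol m) (n : ℤ) (x : Vec m) :
    Matrix.toEuclideanCLM (𝕜 := ℂ) (a.coeff n) x = fourierCoeff (fun θ => a.toCLM θ x) n := by
  let L : Matrix (Fin m) (Fin m) ℂ →L[ℂ] Vec m := LinearMap.toContinuousLinearMap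
    { toFun := fun M => Matrix.toEuclideanCLM (𝕜 := ℂ) M x
      map_add' := fun M N => by rw [map_add]; rfl
      map_smul' := fun c M => by rw [map_smul]; rfl }
  have hL : (∫ θ : Angle, L ((fourier (-n) θ : ℂ) • a θ.toCircle) ∂σ) = L (a.coeff n) :=
    ContinuousLinearMap.integral_comp_comm L
      (φ := fun θ : Angle => (fourier (-n) θ : ℂ) • a θ.toCircle) <|
      Continuous.integrable_of_hasCompactSupport
        ((fourier (-n)).continuous.smul (a.continuous.comp AddCircle.continuous_toCircle))
        (HasCompactSupport.of_compactSpace _)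
  simp only [map_smul] at hL
  exact hL.symm

lemma coeffCLM_mulOp_monomial (a : Symbol m) (k n : ℤ) (x : Vec m) :
    coeffCLM m k (mulOp a (monomial n x)) =
      Matrix.toEuclideanCLM (𝕜 := ℂ) (a.coeff (k - n)) x := by
  rw [toEuclideanCLM_coeff_apply, coeffCLM_apply]
  refine integral_congr_ae ?_
  filter_upwards [coeFn_mulOp a (monomial n x), coeFn_monomial n x] with θ hmul hmono
  rw [hmul, hmono, map_smul, smul_smul, ← fourier_add]
  congr 2
  ring_nf

lemma coeff_star (a : Symbol m) (n : ℤ) : (star a).coeff n = (a.coeff (-n)).conjTranspose := by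
  have hinj : Function.Injective (Matrix.toEuclideanCLM (n := Fin m) (𝕜 := ℂ)) :=
    EquivLike.injective _
  apply hinj
  ext1 x
  refine ext_inner_left ℂ fun y => ?_
  have hstar := coeffCLM_mulOp_monomial (star a) n 0 x
  have ha := coeffCLM_mulOp_monomial a 0 n y
  rw [sub_zero] at hstar
  rw [zero_sub] at ha
  rw [← hstar, ← inner_monomial_left, ← inner_mulOp_left, ← inner_conj_symm, inner_monomial_left,
    ha, inner_conj_symm, ← Matrix.star_eq_conjTranspose, map_star,
    ContinuousLinearMap.star_eq_adjoint, ContinuousLinearMap.adjoint_inner_right]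

end L2

/-! ### Toeplitz and Hankel operators -/

section Toeplitz

variable {m : ℕ}

/-- Multiplication by `a` maps `H²` into itself; on `L²` this plays the role of `a ∈ H^∞`. -/
def PreservesH2 (a : Symbol m) : Prop := ∀ f ∈ H2 m, mulOp a f ∈ H2 m

/-- Multiplication by `a` maps the orthogonal complement of `H²` into itself; on `L²` this plays
the role of `a` being the complex conjugate of an `H^∞` function. -/
def PreservesH2Compl (a : Symbol m) : Prop := ∀ f ∈ (H2 m)ᗮ, mulOp a f ∈ (H2 m)ᗮ

lemma PreservesH2.star {a : Symbol m} (h : PreservesH2 a) : PreservesH2Compl (star a) :=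
  fun f hf => (Submodule.mem_orthogonal _ _).mpr fun g hg => by
    rw [← inner_mulOp_left]
    exact (Submodule.mem_orthogonal _ _).mp hf _ (h g hg)

lemma PreservesH2Compl.star {a : Symbol m} (h : PreservesH2Compl a) : PreservesH2 (star a) := by
  intro f hf
  rw [← (H2 m).orthogonal_orthogonal, Submodule.mem_orthogonal]
  intro g hg
  rw [← inner_mulOp_left]
  exact (Submodule.mem_orthogonal' _ _).mp (h g hg) _ hf

lemma isCoanalytic_star {a : Symbol m} (h : a.IsAnalytic) : (star a).IsCoanalytic := fun n hn => by
  rw [coeff_star, h (-n) (by omega), Matrix.conjTranspose_zero]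

lemma preservesH2Compl_of_isCoanalytic {a : Symbol m} (h : a.IsCoanalytic) :
    PreservesH2Compl a := by
  intro f hf
  rw [mem_H2_orthogonal_iff]
  intro n hn
  refine ext_inner_left ℂ fun x => ?_
  rw [← inner_monomial_left, inner_zero_right, ← star_star a, ← inner_mulOp_left]
  refine (Submodule.mem_orthogonal _ _).mp hf _ (mem_H2_iff_coeffCLM.mpr fun k hk => ?_)
  rw [coeffCLM_mulOp_monomial, coeff_star, h _ (by omega), Matrix.conjTranspose_zero, map_zero,
    zero_apply]

lemma preservesH2_of_isAnalytic {a : Symbol m} (h : a.IsAnalytic) : PreservesH2 a :=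
  star_star a ▸ (preservesH2Compl_of_isCoanalytic (isCoanalytic_star h)).star

lemma PreservesH2.mul {a b : Symbol m} (ha : PreservesH2 a) (hb : PreservesH2 b) :
    PreservesH2 (a * b) := fun f hf => by
  rw [mulOp_mul]
  exact ha _ (hb f hf)

lemma preservesH2_one : PreservesH2 (1 : Symbol m) := fun f hf => by
  rwa [mulOp_one]

lemma coe_toeplitz (a : Symbol m) (f : H2 m) :
    (toeplitz a f : L2 m) = (H2 m).starProjection (mulOp a f) := rfl

lemma coe_toeplitz_of_preservesH2 {a : Symbol m} (ha : PreservesH2 a) (f : H2 m) :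
    (toeplitz a f : L2 m) = mulOp a f := by
  rw [coe_toeplitz, Submodule.starProjection_eq_self_iff]
  exact ha f f.2

lemma starProjection_mulOp_starProjection {a : Symbol m} (ha : PreservesH2Compl a) (f : L2 m) :
    (H2 m).starProjection (mulOp a ((H2 m).starProjection f)) =
      (H2 m).starProjection (mulOp a f) := by
  have h := (H2 m).starProjection_apply_eq_zero_iff.mpr
    (ha _ ((H2 m).sub_starProjection_mem_orthogonal f))
  rw [map_sub, map_sub, sub_eq_zero] at h
  exact h.symm

lemma toeplitz_mul_of_right (a : Symbol m) {b : Symbol m} (hb : PreservesH2 b) :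
    toeplitz (a * b) = toeplitz a ∘L toeplitz b := by
  ext1 f
  apply Subtype.ext
  rw [ContinuousLinearMap.comp_apply, coe_toeplitz, coe_toeplitz,
    coe_toeplitz_of_preservesH2 hb, mulOp_mul, ContinuousLinearMap.comp_apply]

lemma toeplitz_mul_of_left {a : Symbol m} (ha : PreservesH2Compl a) (b : Symbol m) :
    toeplitz (a * b) = toeplitz a ∘L toeplitz b := by
  ext1 f
  apply Subtype.ext
  rw [ContinuousLinearMap.comp_apply, coe_toeplitz, coe_toeplitz, coe_toeplitz,
    starProjection_mulOp_starProjection ha, mulOp_mul, ContinuousLinearMap.comp_apply]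

lemma toeplitz_one : toeplitz (1 : Symbol m) = 1 := by
  ext1 f
  apply Subtype.ext
  rw [coe_toeplitz_of_preservesH2 preservesH2_one, mulOp_one]
  rfl

lemma inner_toeplitz_right (a : Symbol m) (f g : H2 m) :
    inner ℂ f (toeplitz a g) = inner ℂ (f : L2 m) (mulOp a g) := by
  rw [Submodule.coe_inner, coe_toeplitz, ← Submodule.inner_starProjection_left_eq_right,
    Submodule.starProjection_eq_self_iff.mpr f.2]

lemma adjoint_toeplitz (a : Symbol m) :
    ContinuousLinearMap.adjoint (toeplitz a) = toeplitz (star a) := by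
  rw [eq_comm, ContinuousLinearMap.eq_adjoint_iff]
  intro f g
  rw [inner_toeplitz_right, ← inner_conj_symm, inner_toeplitz_right, inner_conj_symm,
    inner_mulOp_left, star_star]

lemma coeFn_flipOp (f : L2 m) :
    (flipOp m f : Angle → Vec m) =ᵐ[σ] fun θ => ((θ.toCircle⁻¹ : Circle) : ℂ) • f (-θ) := by
  filter_upwards [coeFn_mulOp (invSymbol m) (Lp.compMeasurePreserving (fun θ : Angle => -θ)
      (Measure.measurePreserving_neg σ) f),
    Lp.coeFn_compMeasurePreserving f (Measure.measurePreserving_neg σ)] with θ hmul hneg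
  rw [hneg, toCLM_apply] at hmul
  refine hmul.trans ?_
  simp [invSymbol]

lemma coeffCLM_flipOp (n : ℤ) (f : L2 m) :
    coeffCLM m n (flipOp m f) = coeffCLM m (-1 - n) f := by
  rw [coeffCLM_apply, coeffCLM_apply, fourierCoeff_congr_ae (coeFn_flipOp f), fourierCoeff,
    fourierCoeff, ← integral_neg_eq_self]
  congr 1 with θ : 1
  simp [smul_smul, fourier_apply, AddCircle.toCircle_neg]

lemma flipOp_flipOp (f : L2 m) : flipOp m (flipOp m f) = f :=
  ext_coeffCLM fun n => by
    rw [coeffCLM_flipOp, coeffCLM_flipOp, sub_sub_cancel]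

lemma starProjection_orthogonal_H2_flipOp (f : L2 m) :
    (H2 m)ᗮ.starProjection (flipOp m f) = flipOp m ((H2 m).starProjection f) := by
  refine ext_coeffCLM fun n => ?_
  rw [Submodule.starProjection_orthogonal_val, map_sub, coeffCLM_flipOp, coeffCLM_starProjection_H2,
    coeffCLM_flipOp, coeffCLM_flipOp, coeffCLM_starProjection_H2]
  by_cases hn : 0 ≤ n
  · rw [if_pos hn, if_neg (by omega), sub_self]
  · rw [if_neg hn, if_pos (by omega), sub_zero]

lemma mulOp_reversal_flipOp (c : Symbol m) (f : L2 m) :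
    mulOp (reversal c) (flipOp m f) = flipOp m (mulOp c f) := by
  refine Lp.ext ?_
  filter_upwards [coeFn_mulOp (reversal c) (flipOp m f), coeFn_flipOp f,
    coeFn_flipOp (mulOp c f), (Measure.measurePreserving_neg σ).quasiMeasurePreserving.ae
      (coeFn_mulOp c f)] with θ hreversal hflip hflip_mul hmul
  rw [hreversal, hflip, hflip_mul, hmul, map_smul, toCLM_apply, toCLM_apply,
    AddCircle.toCircle_neg]
  rfl

lemma hankel_apply (b : Symbol m) (f : H2 m) :
    hankel b f = (H2 m).orthogonalProjectionOnto (mulOp b (flipOp m f)) := by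
  have hflip := starProjection_orthogonal_H2_flipOp (f : L2 m)
  rw [Submodule.starProjection_eq_self_iff.mpr f.2, Submodule.starProjection_orthogonal'] at hflip
  exact congrArg (fun g => (H2 m).orthogonalProjectionOnto (mulOp b g)) hflip

lemma hankelProduct_apply (b c : Symbol m) (f : H2 m) :
    hankelProduct b c f = (H2 m).orthogonalProjectionOnto
      (mulOp b ((H2 m)ᗮ.starProjection (mulOp c f))) := by
  have hcoe : (hankel (reversal c) f : L2 m) = (H2 m).starProjection (flipOp m (mulOp c f)) := by
    rw [hankel_apply, mulOp_reversal_flipOp]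
    rfl
  rw [hankelProduct, ContinuousLinearMap.comp_apply, hankel_apply, hcoe,
    ← starProjection_orthogonal_H2_flipOp, flipOp_flipOp]

lemma one_sub_hankelProduct {b c : Symbol m} (hbc : b * c = 1) :
    1 - hankelProduct b c = toeplitz b ∘L toeplitz c := by
  ext1 f
  have hbc_apply : mulOp b (mulOp c (f : L2 m)) = f := by
    rw [← ContinuousLinearMap.comp_apply, ← mulOp_mul, hbc, mulOp_one, one_apply_eq_self]
  have hf : (H2 m).orthogonalProjectionOnto (f : L2 m) = f :=
    Submodule.orthogonalProjectionOnto_mem_subspace_eq_self f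
  rw [sub_apply, hankelProduct_apply, Submodule.starProjection_orthogonal_val, map_sub, map_sub,
    hbc_apply, hf, one_apply_eq_self, sub_sub_cancel]
  rfl

/-- The map `f ↦ P (b (I - P) f)` from `L²` to `H²`. It is the Hankel operator `H(b)` without the
flip, and is used because its matrix entries are the Fourier coefficients of `b`. -/
def outerHankel (b : Symbol m) : L2 m →L[ℂ] H2 m :=
  (H2 m).orthogonalProjectionOnto ∘L mulOp b ∘L (H2 m)ᗮ.starProjection

lemma coe_outerHankel (b : Symbol m) (f : L2 m) :
    (outerHankel b f : L2 m) =
      (H2 m).starProjection (mulOp b ((H2 m)ᗮ.starProjection f)) := rfl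

lemma adjoint_outerHankel (b : Symbol m) :
    ContinuousLinearMap.adjoint (outerHankel b) =
      (H2 m)ᗮ.starProjection ∘L mulOp (star b) ∘L (H2 m).subtypeL := by
  rw [outerHankel, ContinuousLinearMap.adjoint_comp, ContinuousLinearMap.adjoint_comp,
    adjoint_mulOp, Submodule.adjoint_orthogonalProjectionOnto,
    (isSelfAdjoint_starProjection (H2 m)ᗮ).adjoint_eq, ContinuousLinearMap.comp_assoc]

lemma hankelProduct_eq_outerHankel_comp_adjoint (b c : Symbol m) :
    hankelProduct b c = outerHankel b ∘L ContinuousLinearMap.adjoint (outerHankel (star c)) := by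
  ext1 f
  have hidem (g : L2 m) : (H2 m)ᗮ.starProjection ((H2 m)ᗮ.starProjection g) =
      (H2 m)ᗮ.starProjection g :=
    Submodule.starProjection_eq_self_iff.mpr (Submodule.starProjection_apply_mem _ g)
  rw [adjoint_outerHankel, star_star, hankelProduct_apply, ← hidem]
  rfl

lemma outerHankel_mul {ψ : Symbol m} (hψ : PreservesH2Compl ψ) (χ : Symbol m) :
    outerHankel (ψ * χ) = toeplitz ψ ∘L outerHankel χ := by
  ext1 f
  apply Subtype.ext
  rw [ContinuousLinearMap.comp_apply, coe_toeplitz, coe_outerHankel, coe_outerHankel,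
    starProjection_mulOp_starProjection hψ, mulOp_mul, ContinuousLinearMap.comp_apply]

end Toeplitz

/-! ### Hankel operators of Krein algebra symbols are Hilbert–Schmidt -/

section HilbertSchmidt

variable {m : ℕ}

lemma hasSum_norm_coeffCLM_sq (f : L2 m) :
    HasSum (fun n => ‖coeffCLM m n f‖ ^ 2) (‖f‖ ^ 2) := by
  refine (hasSum_norm_inner_sq (monomialBasis m) f).prod_fiberwise fun n => ?_
  simpa [EuclideanSpace.norm_sq_eq, monomialBasis_apply, inner_monomial_left,
    EuclideanSpace.inner_single_left] using
    hasSum_fintype fun i : Fin m => ‖coeffCLM m n f i‖ ^ 2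

lemma norm_toEuclideanCLM_single_sq_le (M : Matrix (Fin m) (Fin m) ℂ) (i : Fin m) :
    ‖Matrix.toEuclideanCLM (𝕜 := ℂ) M (EuclideanSpace.single i (1 : ℂ))‖ ^ 2 ≤ m * ‖M‖ ^ 2 := by
  calc ‖Matrix.toEuclideanCLM (𝕜 := ℂ) M (EuclideanSpace.single i (1 : ℂ))‖ ^ 2
      = ∑ j, ‖M j i‖ ^ 2 := by simp [EuclideanSpace.norm_sq_eq, Matrix.ofLp_toEuclideanCLM]
    _ ≤ ∑ _j : Fin m, ‖M‖ ^ 2 := by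
      gcongr with j
      exact Matrix.norm_entry_le_entrywise_sup_norm M
    _ = m * ‖M‖ ^ 2 := by simp

/-- A difference `d` of `k ≥ 0` and `n < 0` occurs for exactly `d⁺` pairs `(n, k)`. -/
lemma summable_ite_sub {g : ℤ → ℝ} (hg : ∀ d, 0 ≤ g d)
    (hs : Summable fun d : ℤ => |(d : ℝ)| * g d) :
    Summable fun p : ℤ × ℤ => if p.1 < 0 ∧ 0 ≤ p.2 then g (p.2 - p.1) else 0 := by
  let e : ℤ × ℤ ≃ ℤ × ℤ :=
    { toFun := fun q => (q.2 - q.1, q.2)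
      invFun := fun p => (p.2 - p.1, p.2)
      left_inv := fun q => by simp
      right_inv := fun p => by simp }
  have hreindex : ((fun p : ℤ × ℤ => if p.1 < 0 ∧ 0 ≤ p.2 then g (p.2 - p.1) else 0) ∘ e) =
      fun q : ℤ × ℤ => if q.2 ∈ Finset.Ico 0 q.1 then g q.1 else 0 := by
    funext q
    simp [e, and_comm]
  have hnonneg (q : ℤ × ℤ) : 0 ≤ if q.2 ∈ Finset.Ico 0 q.1 then g q.1 else 0 := by
    split_ifs
    exacts [hg _, le_rfl]
  have hfibre (d : ℤ) : HasSum (fun k : ℤ => if k ∈ Finset.Ico 0 d then g d else 0)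
      (d.toNat * g d) := by
    convert! hasSum_sum_of_ne_finset_zero (L := .unconditional ℤ) (s := Finset.Ico 0 d)
      (f := fun k : ℤ => if k ∈ Finset.Ico 0 d then g d else 0) (fun k hk => if_neg hk) using 1
    rw [Finset.sum_congr rfl fun k hk => if_pos hk]
    simp
  rw [← e.summable_iff, hreindex, summable_prod_of_nonneg hnonneg]
  refine ⟨fun d => (hfibre d).summable, ?_⟩
  simp only [fun d => (hfibre d).tsum_eq]
  refine Summable.of_nonneg_of_le (fun d => mul_nonneg (Nat.cast_nonneg _) (hg d))
    (fun d => mul_le_mul_of_nonneg_right ?_ (hg d)) hs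
  exact_mod_cast (by rcases abs_cases d with h | h <;> omega : (d.toNat : ℤ) ≤ |d|)

lemma coeffCLM_outerHankel_monomial (χ : Symbol m) (n k : ℤ) (x : Vec m) :
    coeffCLM m k (outerHankel χ (monomial n x)) =
      if n < 0 ∧ 0 ≤ k then Matrix.toEuclideanCLM (𝕜 := ℂ) (χ.coeff (k - n)) x else 0 := by
  rw [coe_outerHankel, coeffCLM_starProjection_H2, Submodule.starProjection_orthogonal_val]
  by_cases hn : n < 0
  · have hzero : (H2 m).starProjection (monomial n x) = 0 := by
      rw [Submodule.starProjection_apply_eq_zero_iff, mem_H2_orthogonal_iff]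
      intro k hk
      rw [coeffCLM_monomial, if_neg (by omega)]
    simp only [hzero, sub_zero, coeffCLM_mulOp_monomial, hn, true_and]
  · rw [Submodule.starProjection_eq_self_iff.mpr (monomial_mem_H2 (not_lt.mp hn) x)]
    simp [hn]

lemma isHilbertSchmidt_outerHankel {χ : Symbol m}
    (hχ : Summable fun n : ℤ => |(n : ℝ)| * ‖χ.coeff n‖ ^ 2) :
    IsHilbertSchmidt (monomialBasis m) (outerHankel χ) := by
  have hs := (summable_ite_sub (fun d => sq_nonneg ‖χ.coeff d‖) hχ).mul_left (m : ℝ)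
  have hrow : Summable fun n : ℤ => ∑' k : ℤ,
      (m : ℝ) * if n < 0 ∧ 0 ≤ k then ‖χ.coeff (k - n)‖ ^ 2 else 0 := hs.prod
  have hprod := hrow.mul_of_nonneg (hasSum_fintype fun _ : Fin m => (1 : ℝ)).summable
    (fun n => tsum_nonneg fun k => by positivity) fun _ => zero_le_one
  refine Summable.of_nonneg_of_le (fun p => by positivity) (fun ⟨n, i⟩ => ?_) hprod
  rw [mul_one, monomialBasis_apply]
  refine hasSum_le (fun k => ?_)
    (hasSum_norm_coeffCLM_sq (outerHankel χ (monomial n _) : L2 m)) (hs.prod_factor n).hasSum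
  rw [coeffCLM_outerHankel_monomial]
  dsimp only
  split_ifs
  · exact norm_toEuclideanCLM_single_sq_le _ _
  · simp

end HilbertSchmidt

/-! ### Reproducing kernels -/

section Kernel

variable {m : ℕ}

lemma ext_coeff_H2 {f g : H2 m}
    (h : ∀ n : ℕ, coeffCLM m n (f : L2 m) = coeffCLM m n (g : L2 m)) : f = g := by
  refine Subtype.ext (ext_coeffCLM fun n => ?_)
  by_cases hn : 0 ≤ n
  · lift n to ℕ using hn
    exact h n
  · rw [mem_H2_iff_coeffCLM.mp f.2 n (by omega), mem_H2_iff_coeffCLM.mp g.2 n (by omega)]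

lemma norm_diskValue_le (f : H2 m) (z : 𝔻) : ‖diskValue f z‖ ≤ (1 - ‖(z : ℂ)‖)⁻¹ * ‖f‖ := by
  refine tsum_of_norm_bounded
    ((hasSum_geometric_of_lt_one (norm_nonneg (z : ℂ)) z.norm_lt_one).mul_right ‖f‖) fun n => ?_
  rw [norm_smul, norm_pow, Submodule.coe_norm f]
  gcongr
  exact norm_coeffCLM_le n (f : L2 m)

/-- Evaluation at the point `z` of the disk, `f ↦ diskValue f z`, as a bounded operator. -/
def diskEval (m : ℕ) (z : 𝔻) : H2 m →L[ℂ] Vec m :=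
  LinearMap.mkContinuous
    { toFun := fun f => diskValue f z
      map_add' := fun f g => by
        simp only [diskValue, Submodule.coe_add, map_add, smul_add]
        exact (summable_diskValue f z).tsum_add (summable_diskValue g z)
      map_smul' := fun c f => by
        simp only [diskValue, Submodule.coe_smul, map_smul, smul_comm _ c, RingHom.id_apply]
        exact (summable_diskValue f z).tsum_const_smul c }
    (1 - ‖(z : ℂ)‖)⁻¹ fun f => norm_diskValue_le f z

lemma diskEval_apply (z : 𝔻) (f : H2 m) : diskEval m z f = diskValue f z := rfl

lemma diskValue_sub (f g : H2 m) (z : 𝔻) :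
    diskValue (f - g) z = diskValue f z - diskValue g z := by
  simp only [← diskEval_apply, map_sub]

lemma diskValue_smul (c : ℂ) (f : H2 m) (z : 𝔻) :
    diskValue (c • f) z = c • diskValue f z := by
  simp only [← diskEval_apply, map_smul]

lemma ext_diskValue {f g : H2 m} (h : ∀ z, diskValue f z = diskValue g z) : f = g := by
  rw [← sub_eq_zero]
  set u := f - g with hu
  have hzero (z : 𝔻) : diskValue u z = 0 := by rw [hu, diskValue_sub, h, sub_self]
  let p : FormalMultilinearSeries ℂ ℂ (Vec m) := fun n =>
    ContinuousMultilinearMap.mkPiRing ℂ (Fin n) (coeffCLM m n (u : L2 m))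
  have hp (n : ℕ) : p.coeff n = coeffCLM m n (u : L2 m) := by
    simp [p, FormalMultilinearSeries.coeff]
  have hps : HasFPowerSeriesAt (0 : ℂ → Vec m) p 0 := by
    rw [hasFPowerSeriesAt_iff]
    filter_upwards [Metric.ball_mem_nhds (0 : ℂ) one_pos] with z hz
    have hsum := (summable_diskValue u (UnitDisc.mk z (by simpa using hz))).hasSum
    rw [← diskValue, hzero] at hsum
    simpa [hp] using hsum
  refine ext_coeff_H2 fun n => ?_
  rw [← hp, hps.eq_zero]
  simp [FormalMultilinearSeries.coeff]

/-- The map `x ↦ x / (1 - ᾱ t)`, which is the adjoint of the evaluation at `α`. -/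
def kernel (α : 𝔻) : Vec m →L[ℂ] H2 m := ContinuousLinearMap.adjoint (diskEval m α)

lemma inner_kernel_left (α : 𝔻) (x : Vec m) (f : H2 m) :
    inner ℂ (kernel α x) f = inner ℂ x (diskValue f α) := by
  rw [kernel, ContinuousLinearMap.adjoint_inner_left, diskEval_apply]

lemma inner_coeffCLM (x : Vec m) (n : ℕ) (f : H2 m) :
    inner ℂ x (coeffCLM m n (f : L2 m)) =
      inner ℂ (⟨monomial n x, monomial_mem_H2 n.cast_nonneg x⟩ : H2 m) f := by
  rw [← inner_monomial_left, Submodule.coe_inner]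

lemma diskValue_monomial (n : ℕ) (x : Vec m) (z : 𝔻) :
    diskValue (⟨monomial n x, monomial_mem_H2 n.cast_nonneg x⟩ : H2 m) z = (z : ℂ) ^ n • x := by
  rw [diskValue, tsum_eq_single n fun k hk => ?_]
  · simp [coeffCLM_monomial]
  · simp [coeffCLM_monomial, hk]

lemma coeffCLM_kernel (α : 𝔻) (x : Vec m) (n : ℕ) :
    coeffCLM m n (kernel α x : L2 m) = conj (α : ℂ) ^ n • x := by
  refine ext_inner_left ℂ fun y => ?_
  rw [inner_coeffCLM, ← inner_conj_symm _ (kernel α x), inner_kernel_left, diskValue_monomial,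
    inner_smul_right, inner_smul_right, map_mul, inner_conj_symm, map_pow]

lemma kernel_injective (α : 𝔻) : Function.Injective (kernel α : Vec m → H2 m) := fun x y h => by
  have hzero := coeffCLM_kernel α x 0
  rw [h, coeffCLM_kernel] at hzero
  simpa using hzero.symm

/-- The matrix function `∑ w_{-n} zⁿ`, whose value at `t̄` is `w(t)` if `w` is coanalytic. -/
def coSeries (w : Symbol m) (z : ℂ) : Matrix (Fin m) (Fin m) ℂ :=
  ∑' n : ℕ, z ^ n • w.coeff (-(n : ℤ))

lemma summable_norm_coeff_neg {w : Symbol m} (hw : Summable fun n : ℤ => ‖w.coeff n‖) :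
    Summable fun n : ℕ => ‖w.coeff (-(n : ℤ))‖ :=
  hw.comp_injective (i := fun n : ℕ => -(n : ℤ)) fun a b h => by simpa using h

lemma hasSum_coSeries {w : Symbol m} (hw : Summable fun n : ℤ => ‖w.coeff n‖) {z : ℂ}
    (hz : ‖z‖ ≤ 1) : HasSum (fun n : ℕ => z ^ n • w.coeff (-(n : ℤ))) (coSeries w z) := by
  refine Summable.hasSum (Summable.of_norm_bounded (summable_norm_coeff_neg hw) fun n => ?_)
  rw [norm_smul, norm_pow]
  exact mul_le_of_le_one_left (norm_nonneg _) (pow_le_one₀ (norm_nonneg _) hz)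

lemma hasSum_toEuclideanCLM_coSeries_conj {w : Symbol m} (hw : Summable fun n : ℤ => ‖w.coeff n‖)
    (α : 𝔻) (x : Vec m) :
    HasSum (fun n : ℕ => (α : ℂ) ^ n •
        Matrix.toEuclideanCLM (𝕜 := ℂ) ((star w).coeff n) x)
      (Matrix.toEuclideanCLM (𝕜 := ℂ) (coSeries w (conj (α : ℂ))).conjTranspose x) := by
  have hsum := (hasSum_coSeries hw (z := conj (α : ℂ))
    (by rw [RCLike.norm_conj]; exact α.norm_lt_one.le)).matrix_conjTranspose
  let L : Matrix (Fin m) (Fin m) ℂ →ₗ[ℂ] Vec m :=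
    { toFun := fun M => Matrix.toEuclideanCLM (𝕜 := ℂ) M x
      map_add' := fun M N => by rw [map_add]; rfl
      map_smul' := fun c M => by rw [map_smul]; rfl }
  refine (hsum.map L L.continuous_of_finiteDimensional).congr_fun fun n => ?_
  simp [L, coeff_star]

lemma diskValue_toeplitz_star_monomial {w : Symbol m} (hw : Summable fun n : ℤ => ‖w.coeff n‖)
    (hco : w.IsCoanalytic) (α : 𝔻) (n : ℕ) (x : Vec m) :
    diskValue (toeplitz (star w) ⟨monomial n x, monomial_mem_H2 n.cast_nonneg x⟩) α =
      (α : ℂ) ^ n • Matrix.toEuclideanCLM (𝕜 := ℂ) (coSeries w (conj (α : ℂ))).conjTranspose x := by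
  have hcoeff (k : ℕ) : coeffCLM m k (toeplitz (star w)
      ⟨monomial n x, monomial_mem_H2 n.cast_nonneg x⟩ : L2 m) =
        Matrix.toEuclideanCLM (𝕜 := ℂ) ((star w).coeff (k - n)) x := by
    rw [coe_toeplitz, coeffCLM_starProjection_H2, if_pos k.cast_nonneg, coeffCLM_mulOp_monomial]
  simp only [diskValue, hcoeff]
  refine HasSum.tsum_eq (((add_left_injective n).hasSum_iff fun k hk => ?_).mp ?_)
  · have hkn : k < n := by
      by_contra! hle
      exact hk ⟨k - n, Nat.sub_add_cancel hle⟩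
    rw [coeff_star, hco _ (by omega), Matrix.conjTranspose_zero, map_zero, zero_apply, smul_zero]
  · refine ((hasSum_toEuclideanCLM_coSeries_conj hw α x).const_smul ((α : ℂ) ^ n)).congr_fun
      fun k => ?_
    simp [smul_smul, pow_add, mul_comm]

lemma toeplitz_kernel {w : Symbol m} (hw : Summable fun n : ℤ => ‖w.coeff n‖)
    (hco : w.IsCoanalytic) (α : 𝔻) (x : Vec m) :
    toeplitz w (kernel α x) =
      kernel α (Matrix.toEuclideanCLM (𝕜 := ℂ) (coSeries w (conj (α : ℂ))) x) := by
  refine ext_coeff_H2 fun n => ext_inner_left ℂ fun y => ?_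
  rw [inner_coeffCLM, inner_coeffCLM, ← ContinuousLinearMap.adjoint_inner_left, adjoint_toeplitz,
    ← inner_conj_symm, inner_kernel_left, diskValue_toeplitz_star_monomial hw hco,
    ← inner_conj_symm _ (kernel α _), inner_kernel_left, diskValue_monomial, inner_smul_right,
    inner_smul_right, ← Matrix.star_eq_conjTranspose, map_star,
    ContinuousLinearMap.star_eq_adjoint, ContinuousLinearMap.adjoint_inner_right]

lemma coSeries_mul_coSeries {w w' : Symbol m} (hw : Summable fun n : ℤ => ‖w.coeff n‖)
    (hco : w.IsCoanalytic) (hw' : Summable fun n : ℤ => ‖w'.coeff n‖)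
    (hco' : w'.IsCoanalytic) (h : w * w' = 1) {z : ℂ} (hz : ‖z‖ < 1) :
    coSeries w z * coSeries w' z = 1 := by
  have hinj : Function.Injective (Matrix.toEuclideanCLM (n := Fin m) (𝕜 := ℂ)) :=
    EquivLike.injective _
  let α : 𝔻 := UnitDisc.mk (conj z) (by rwa [RCLike.norm_conj])
  have hα : conj (α : ℂ) = z := by simp [α]
  apply hinj
  ext1 x
  apply kernel_injective α
  have hT := toeplitz_mul_of_left (preservesH2Compl_of_isCoanalytic hco) w'
  rw [h, toeplitz_one] at hT
  rw [map_mul, map_one, mul_apply_eq_comp, ← hα, ← toeplitz_kernel hw hco,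
    ← toeplitz_kernel hw' hco', ← ContinuousLinearMap.comp_apply, ← hT]
  rfl

end Kernel

/-! ### Blaschke factors -/

section BlaschkeFactor

variable {m : ℕ}

/-- The scalar symbol `t ↦ t`. -/
def shiftSymbol (m : ℕ) : Symbol m where
  toFun t := (t : ℂ) • (1 : Matrix (Fin m) (Fin m) ℂ)
  continuous_toFun := by fun_prop

lemma coeffCLM_mulOp_shiftSymbol (n : ℤ) (f : L2 m) :
    coeffCLM m n (mulOp (shiftSymbol m) f) = coeffCLM m (n - 1) f := by
  rw [coeffCLM_apply, coeffCLM_apply, fourierCoeff_congr_ae (coeFn_mulOp _ f), fourierCoeff,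
    fourierCoeff]
  refine integral_congr_ae (Eventually.of_forall fun θ => ?_)
  have hshift : (fourier (-(n - 1)) θ : ℂ) = fourier (-n) θ * θ.toCircle := by
    rw [← fourier_one, ← fourier_add, neg_sub, sub_eq_neg_add]
  simp only [hshift, mul_smul, toCLM_apply]
  simp [shiftSymbol]

lemma preservesH2_shiftSymbol : PreservesH2 (shiftSymbol m) := fun f hf =>
  mem_H2_iff_coeffCLM.mpr fun n hn => by
    rw [coeffCLM_mulOp_shiftSymbol, mem_H2_iff_coeffCLM.mp hf _ (by omega)]

lemma diskValue_toeplitz_shiftSymbol (f : H2 m) (z : 𝔻) :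
    diskValue (toeplitz (shiftSymbol m) f) z = (z : ℂ) • diskValue f z := by
  have hcoeff (n : ℤ) : coeffCLM m n (toeplitz (shiftSymbol m) f : L2 m) =
      coeffCLM m (n - 1) (f : L2 m) := by
    rw [coe_toeplitz_of_preservesH2 preservesH2_shiftSymbol, coeffCLM_mulOp_shiftSymbol]
  rw [diskValue, (summable_diskValue _ z).tsum_eq_zero_add, hcoeff,
    mem_H2_iff_coeffCLM.mp f.2 _ (by simp), smul_zero, zero_add, diskValue,
    ← (summable_diskValue f z).tsum_const_smul]
  exact tsum_congr fun n => by simp [hcoeff, pow_succ', mul_smul]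

/-- The unimodular constant `-ᾱ / |α|` in the definition of `B_α`, which is `1` for `α = 0`. -/
def blaschkeConst (α : 𝔻) : ℂ :=
  open Classical in if α = 0 then 1 else -conj (α : ℂ) / (‖(α : ℂ)‖ : ℂ)

lemma norm_blaschkeConst (α : 𝔻) : ‖blaschkeConst α‖ = 1 := by
  unfold blaschkeConst
  split_ifs with hα
  · exact norm_one
  · have hnorm : ‖(α : ℂ)‖ ≠ 0 := by simpa using hα
    rw [norm_div, norm_neg, RCLike.norm_conj, Complex.norm_real, norm_norm, div_self hnorm]

lemma blaschkeFactor_eq (α z : 𝔻) :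
    blaschkeFactor α z = blaschkeConst α * (((z : ℂ) - α) / (1 - conj (α : ℂ) * z)) := by
  unfold blaschkeFactor blaschkeConst
  split_ifs with hα
  · simp [hα]
  · rfl

/-- The boundary values of `B_α`, as a scalar symbol. -/
def blaschkeSymbol (m : ℕ) (α : 𝔻) : Symbol m where
  toFun t := (blaschkeConst α * (mobius α t : ℂ)) • (1 : Matrix (Fin m) (Fin m) ℂ)
  continuous_toFun := (continuous_const.mul
    (continuous_subtype_val.comp (mobius α).continuous)).smul continuous_const

lemma blaschkeSymbol_apply (α : 𝔻) (t : Circle) :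
    blaschkeSymbol m α t = (blaschkeConst α * (mobius α t : ℂ)) • 1 := rfl

lemma blaschkeSymbol_mul_comm (α : 𝔻) (a : Symbol m) :
    blaschkeSymbol m α * a = a * blaschkeSymbol m α := by
  ext1 t
  simp [blaschkeSymbol_apply]

lemma star_blaschkeSymbol_mul_self (α : 𝔻) :
    star (blaschkeSymbol m α) * blaschkeSymbol m α = 1 := by
  ext1 t
  rw [ContinuousMap.mul_apply, ContinuousMap.star_apply, blaschkeSymbol_apply, star_smul, star_one,
    smul_mul_smul_comm, mul_one, ← starRingEnd_apply, RCLike.conj_mul, norm_mul,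
    norm_blaschkeConst, Circle.norm_coe]
  simp

lemma blaschkeSymbol_sub_shiftSymbol_mul (α : 𝔻) :
    blaschkeSymbol m α - conj (α : ℂ) • (shiftSymbol m * blaschkeSymbol m α) =
      blaschkeConst α • (shiftSymbol m - (α : ℂ) • 1) := by
  ext1 t
  have hden : 1 - (t : ℂ) * conj (α : ℂ) ≠ 0 := mul_comm (t : ℂ) _ ▸ mobius_denom_ne_zero α t
  have hmobius : (mobius α t : ℂ) = ((t : ℂ) - α) / (1 - (t : ℂ) * conj (α : ℂ)) := by
    rw [mul_comm (t : ℂ)]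
    rfl
  simp only [ContinuousMap.sub_apply, ContinuousMap.smul_apply, ContinuousMap.mul_apply,
    ContinuousMap.one_apply, blaschkeSymbol_apply, shiftSymbol, ContinuousMap.coe_mk,
    smul_mul_smul_comm, mul_one, smul_smul, ← sub_smul, hmobius]
  congr 1
  field_simp

lemma coeffCLM_mulOp_blaschkeSymbol (α : 𝔻) (f : L2 m) (n : ℤ) :
    coeffCLM m n (mulOp (blaschkeSymbol m α) f) -
        conj (α : ℂ) • coeffCLM m (n - 1) (mulOp (blaschkeSymbol m α) f) =
      blaschkeConst α • (coeffCLM m (n - 1) f - (α : ℂ) • coeffCLM m n f) := by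
  have hcoeff := congrArg (fun s => coeffCLM m n (mulOp s f)) (blaschkeSymbol_sub_shiftSymbol_mul α)
  simpa only [mulOp_sub, mulOp_smul, mulOp_mul, mulOp_one, sub_apply, smul_apply,
    ContinuousLinearMap.comp_apply, map_sub, map_smul, coeffCLM_mulOp_shiftSymbol,
    one_apply_eq_self] using hcoeff

lemma preservesH2_blaschkeSymbol (α : 𝔻) : PreservesH2 (blaschkeSymbol m α) := by
  intro f hf
  set h := mulOp (blaschkeSymbol m α) f
  have hrec (n : ℤ) (hn : n < 0) : coeffCLM m n h = conj (α : ℂ) • coeffCLM m (n - 1) h := by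
    rw [← sub_eq_zero, coeffCLM_mulOp_blaschkeSymbol, mem_H2_iff_coeffCLM.mp hf n hn,
      mem_H2_iff_coeffCLM.mp hf (n - 1) (by omega), smul_zero, sub_zero, smul_zero]
  have hbound (k : ℕ) : ∀ n : ℤ, n < 0 → ‖coeffCLM m n h‖ ≤ ‖(α : ℂ)‖ ^ k * ‖h‖ := by
    induction k with
    | zero => simpa using fun n _ => norm_coeffCLM_le n h
    | succ k ih =>
      intro n hn
      rw [hrec n hn, norm_smul, RCLike.norm_conj, pow_succ', mul_assoc]
      exact mul_le_mul_of_nonneg_left (ih (n - 1) (by omega)) (norm_nonneg _)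
  have hlim : Tendsto (fun k : ℕ => ‖(α : ℂ)‖ ^ k * ‖h‖) atTop (𝓝 0) := by
    simpa using (tendsto_pow_atTop_nhds_zero_of_lt_one (norm_nonneg _) α.norm_lt_one).mul_const ‖h‖
  exact mem_H2_iff_coeffCLM.mpr fun n hn =>
    norm_le_zero_iff.mp (ge_of_tendsto' hlim fun k => hbound k n hn)

lemma one_sub_conj_mul_ne_zero (α z : 𝔻) : 1 - conj (α : ℂ) * (z : ℂ) ≠ 0 := by
  refine sub_ne_zero.mpr fun h => ?_
  have hlt : ‖conj (α : ℂ) * (z : ℂ)‖ < 1 := by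
    rw [norm_mul, RCLike.norm_conj]
    exact mul_lt_one_of_nonneg_of_lt_one_left (norm_nonneg _) α.norm_lt_one z.norm_lt_one.le
  rw [← h, norm_one] at hlt
  exact hlt.false

lemma diskValue_toeplitz_blaschkeSymbol (α : 𝔻) (f : H2 m) (z : 𝔻) :
    diskValue (toeplitz (blaschkeSymbol m α) f) z = blaschkeFactor α z • diskValue f z := by
  set g := toeplitz (blaschkeSymbol m α) f with hg
  have hrec : g - conj (α : ℂ) • toeplitz (shiftSymbol m) g =
      blaschkeConst α • (toeplitz (shiftSymbol m) f - (α : ℂ) • f) := by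
    refine ext_coeff_H2 fun n => ?_
    simpa only [hg, Submodule.coe_sub, Submodule.coe_smul, map_sub, map_smul,
      coe_toeplitz_of_preservesH2 preservesH2_shiftSymbol, coeffCLM_mulOp_shiftSymbol,
      coe_toeplitz_of_preservesH2 (preservesH2_blaschkeSymbol α)]
      using coeffCLM_mulOp_blaschkeSymbol α (f : L2 m) n
  have hvalue : (1 - conj (α : ℂ) * z) • diskValue g z =
      (blaschkeConst α * ((z : ℂ) - α)) • diskValue f z := by
    rw [sub_smul, one_smul]
    simpa only [diskValue_sub, diskValue_smul, diskValue_toeplitz_shiftSymbol, smul_smul,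
      ← sub_smul] using congrArg (fun u => diskValue u z) hrec
  rw [blaschkeFactor_eq, mul_div_assoc', div_eq_inv_mul, mul_smul, ← hvalue, smul_smul,
    inv_mul_cancel₀ (one_sub_conj_mul_ne_zero α z), one_smul]

lemma blaschkeFactor_self (α : 𝔻) : blaschkeFactor α α = 0 := by
  simp [blaschkeFactor_eq]

lemma toeplitz_star_blaschkeSymbol_kernel (α : 𝔻) (x : Vec m) :
    toeplitz (star (blaschkeSymbol m α)) (kernel α x) = 0 := by
  refine ext_inner_right ℂ fun g => ?_
  rw [← adjoint_toeplitz, ContinuousLinearMap.adjoint_inner_left, inner_kernel_left,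
    diskValue_toeplitz_blaschkeSymbol, blaschkeFactor_self, zero_smul, inner_zero_right,
    inner_zero_left]

lemma exists_kernel_eq_of_toeplitz_star_blaschkeSymbol {α : 𝔻} {f : H2 m}
    (hf : toeplitz (star (blaschkeSymbol m α)) f = 0) : ∃ x, kernel α x = f := by
  set h := mulOp (star (blaschkeSymbol m α)) f with hh
  have hperp : h ∈ (H2 m)ᗮ := by
    rw [← Submodule.starProjection_apply_eq_zero_iff, hh, ← coe_toeplitz, hf]
    rfl
  have hcoeff {n : ℤ} (hn : 0 ≤ n) : coeffCLM m n h = 0 := mem_H2_orthogonal_iff.mp hperp n hn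
  have hmul : mulOp (blaschkeSymbol m α) h = f := by
    rw [hh, ← ContinuousLinearMap.comp_apply, ← mulOp_mul, blaschkeSymbol_mul_comm,
      star_blaschkeSymbol_mul_self, mulOp_one, one_apply_eq_self]
  have hrec (n : ℕ) : coeffCLM m (n + 1) (f : L2 m) = conj (α : ℂ) • coeffCLM m n (f : L2 m) := by
    have hsub := coeffCLM_mulOp_blaschkeSymbol α h (n + 1)
    rw [hcoeff (by omega), hcoeff (by omega), hmul, smul_zero, sub_zero, smul_zero, sub_eq_zero,
      add_sub_cancel_right] at hsub
    exact hsub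
  refine ⟨coeffCLM m 0 (f : L2 m), ext_coeff_H2 fun n => ?_⟩
  rw [coeffCLM_kernel]
  induction n with
  | zero => simp
  | succ n ih => rw [Nat.cast_succ, hrec, ← ih, smul_smul, pow_succ']

end BlaschkeFactor

/-! ### Model spaces of finite Blaschke products -/

section FiniteBlaschke

variable {m : ℕ} (α : ℕ → 𝔻)

/-- The boundary values of `u_N`, as a scalar symbol. -/
def partialSymbol (m : ℕ) (α : ℕ → 𝔻) : ℕ → Symbol m
  | 0 => 1
  | N + 1 => partialSymbol m α N * blaschkeSymbol m (α N)

lemma partialSymbol_mul_comm (N : ℕ) (a : Symbol m) :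
    partialSymbol m α N * a = a * partialSymbol m α N := by
  induction N with
  | zero => simp [partialSymbol]
  | succ N ih =>
    rw [partialSymbol, mul_assoc, blaschkeSymbol_mul_comm, ← mul_assoc, ih, mul_assoc]

lemma star_partialSymbol_mul_comm (N : ℕ) (a : Symbol m) :
    star (partialSymbol m α N) * a = a * star (partialSymbol m α N) := by
  simpa using (congrArg star (partialSymbol_mul_comm α N (star a))).symm

lemma star_partialSymbol_mul_self (N : ℕ) :
    star (partialSymbol m α N) * partialSymbol m α N = 1 := by
  induction N with
  | zero => simp [partialSymbol]
  | succ N ih =>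
    rw [partialSymbol, star_mul, mul_assoc, ← mul_assoc (star (partialSymbol m α N)), ih, one_mul,
      star_blaschkeSymbol_mul_self]

lemma preservesH2_partialSymbol (N : ℕ) : PreservesH2 (partialSymbol m α N) := by
  induction N with
  | zero => exact preservesH2_one
  | succ N ih => exact ih.mul (preservesH2_blaschkeSymbol _)

lemma diskValue_toeplitz_partialSymbol (N : ℕ) (f : H2 m) (z : 𝔻) :
    diskValue (toeplitz (partialSymbol m α N) f) z = partialBlaschke α N z • diskValue f z := by
  induction N generalizing f with
  | zero => simp [partialSymbol, partialBlaschke, toeplitz_one]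
  | succ N ih =>
    rw [partialSymbol, toeplitz_mul_of_right _ (preservesH2_blaschkeSymbol _),
      ContinuousLinearMap.comp_apply, ih, diskValue_toeplitz_blaschkeSymbol, smul_smul,
      partialBlaschke, partialBlaschke, Finset.prod_range_succ]

lemma toeplitz_star_partialSymbol_conj (w : Symbol m) (N : ℕ) (f : H2 m) :
    toeplitz (star (partialSymbol m α N)) (toeplitz w (toeplitz (partialSymbol m α N) f)) =
      toeplitz w f := by
  simp only [← ContinuousLinearMap.comp_apply]
  rw [← toeplitz_mul_of_right w (preservesH2_partialSymbol α N),
    ← toeplitz_mul_of_left (preservesH2_partialSymbol α N).star, ← mul_assoc,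
    star_partialSymbol_mul_comm, mul_assoc, star_partialSymbol_mul_self, mul_one]

lemma toeplitz_star_partialSymbol_toeplitz (N : ℕ) (f : H2 m) :
    toeplitz (star (partialSymbol m α N)) (toeplitz (partialSymbol m α N) f) = f := by
  simpa [toeplitz_one] using toeplitz_star_partialSymbol_conj α 1 N f

lemma mem_mulH2_partialBlaschke_iff {N : ℕ} {f : H2 m} :
    f ∈ mulH2 m (partialBlaschke α N) ↔ ∃ g, toeplitz (partialSymbol m α N) g = f := by
  constructor
  · rintro ⟨g, hg⟩
    exact ⟨g, ext_diskValue fun z => by rw [diskValue_toeplitz_partialSymbol, hg]⟩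
  · rintro ⟨g, rfl⟩
    exact ⟨g, fun z => diskValue_toeplitz_partialSymbol α N g z⟩

lemma mem_modelSpace_partialBlaschke_iff {N : ℕ} {f : H2 m} :
    f ∈ modelSpace m (partialBlaschke α N) ↔ toeplitz (star (partialSymbol m α N)) f = 0 := by
  rw [modelSpace, Submodule.mem_orthogonal, ← adjoint_toeplitz]
  constructor
  · intro h
    refine ext_inner_left ℂ fun g => ?_
    rw [ContinuousLinearMap.adjoint_inner_right, inner_zero_right]
    exact h _ ((mem_mulH2_partialBlaschke_iff α).mpr ⟨g, rfl⟩)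
  · intro h u hu
    obtain ⟨g, rfl⟩ := (mem_mulH2_partialBlaschke_iff α).mp hu
    rw [← ContinuousLinearMap.adjoint_inner_right, h, inner_zero_right]

/-- The map `x ↦ u_N x / (1 - ᾱ_N t)`, whose range is the orthogonal complement of `K_{u_N}` in
`K_{u_{N+1}}` (a block Takenaka–Malmquist function). -/
def takenakaMap (m N : ℕ) : Vec m →ₗ[ℂ] H2 m :=
  (toeplitz (partialSymbol m α N) ∘L kernel (α N)).toLinearMap

lemma takenakaMap_apply (N : ℕ) (x : Vec m) :
    takenakaMap α m N x = toeplitz (partialSymbol m α N) (kernel (α N) x) := rfl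

lemma takenakaMap_injective (N : ℕ) : Function.Injective (takenakaMap α m N) :=
  (Function.LeftInverse.injective (toeplitz_star_partialSymbol_toeplitz α N)).comp
    (kernel_injective (α N))

lemma modelSpace_partialBlaschke_zero : modelSpace m (partialBlaschke α 0) = ⊥ := by
  refine (Submodule.eq_bot_iff _).mpr fun f hf => ?_
  rwa [mem_modelSpace_partialBlaschke_iff, partialSymbol, star_one, toeplitz_one,
    one_apply_eq_self] at hf

lemma modelSpace_partialBlaschke_succ (N : ℕ) :
    modelSpace m (partialBlaschke α (N + 1)) =
      modelSpace m (partialBlaschke α N) ⊔ LinearMap.range (takenakaMap α m N) := by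
  ext f
  rw [mem_modelSpace_partialBlaschke_iff, partialSymbol, star_mul,
    toeplitz_mul_of_left (preservesH2_blaschkeSymbol _).star, ContinuousLinearMap.comp_apply,
    Submodule.mem_sup]
  constructor
  · intro h
    obtain ⟨x, hx⟩ := exists_kernel_eq_of_toeplitz_star_blaschkeSymbol h
    refine ⟨f - takenakaMap α m N x, ?_, takenakaMap α m N x, ⟨x, rfl⟩, sub_add_cancel _ _⟩
    rw [mem_modelSpace_partialBlaschke_iff, map_sub, takenakaMap_apply,
      toeplitz_star_partialSymbol_toeplitz, hx, sub_self]
  · rintro ⟨g, hg, _, ⟨x, rfl⟩, rfl⟩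
    rw [map_add, (mem_modelSpace_partialBlaschke_iff α).mp hg, zero_add, takenakaMap_apply,
      toeplitz_star_partialSymbol_toeplitz, toeplitz_star_blaschkeSymbol_kernel]

lemma finiteDimensional_modelSpace (m N : ℕ) :
    FiniteDimensional ℂ (modelSpace m (partialBlaschke α N)) := by
  induction N with
  | zero => rw [modelSpace_partialBlaschke_zero]; infer_instance
  | succ N ih => rw [modelSpace_partialBlaschke_succ]; infer_instance

/-- The model space `K_{u_N}` as a finite-dimensional subspace. -/
def finiteModelSpace (m N : ℕ) : FinSubspace (H2 m) :=
  ⟨modelSpace m (partialBlaschke α N), finiteDimensional_modelSpace α m N⟩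

lemma toeplitz_mem_modelSpace {w : Symbol m} (hw : PreservesH2Compl w) {N : ℕ} {f : H2 m}
    (hf : f ∈ modelSpace m (partialBlaschke α N)) :
    toeplitz w f ∈ modelSpace m (partialBlaschke α N) := by
  rw [mem_modelSpace_partialBlaschke_iff] at hf ⊢
  rw [← ContinuousLinearMap.comp_apply,
    ← toeplitz_mul_of_left (preservesH2_partialSymbol α N).star, star_partialSymbol_mul_comm,
    toeplitz_mul_of_left hw, ContinuousLinearMap.comp_apply, hf, map_zero]

lemma isOrtho_modelSpace_range_takenakaMap (N : ℕ) :
    modelSpace m (partialBlaschke α N) ⟂ LinearMap.range (takenakaMap α m N) := by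
  refine (Submodule.isOrtho_orthogonal_left _).mono_right ?_
  rintro _ ⟨x, rfl⟩
  exact (mem_mulH2_partialBlaschke_iff α).mpr ⟨_, rfl⟩

lemma det_toEuclideanCLM (M : Matrix (Fin m) (Fin m) ℂ) :
    LinearMap.det ((Matrix.toEuclideanCLM (𝕜 := ℂ) M : Vec m →L[ℂ] Vec m) : Vec m →ₗ[ℂ] Vec m) =
      M.det := by
  rw [Matrix.coe_toEuclideanCLM_eq_toEuclideanLin, Matrix.toEuclideanLin,
    Matrix.toLpLin_eq_toLin, LinearMap.det_toLin]

lemma detCompress_toeplitz_range_takenakaMap {w : Symbol m}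
    (hw : Summable fun n : ℤ => ‖w.coeff n‖) (hco : w.IsCoanalytic) (N : ℕ) :
    detCompress (toeplitz w) ⟨LinearMap.range (takenakaMap α m N), inferInstance⟩ =
      (coSeries w (conj (α N : ℂ))).det := by
  rw [← det_toEuclideanCLM]
  refine detCompress_range_of_inner (takenakaMap_injective α N) fun u x => ?_
  simp only [takenakaMap_apply]
  have hadj (f g : H2 m) : inner ℂ (toeplitz (partialSymbol m α N) f) g =
      inner ℂ f (toeplitz (star (partialSymbol m α N)) g) := by
    rw [← adjoint_toeplitz, ContinuousLinearMap.adjoint_inner_right]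
  rw [hadj, hadj, toeplitz_star_partialSymbol_conj, toeplitz_star_partialSymbol_toeplitz,
    toeplitz_kernel hw hco]
  rfl

lemma detCompress_toeplitz_modelSpace {w : Symbol m} (hw : Summable fun n : ℤ => ‖w.coeff n‖)
    (hco : w.IsCoanalytic) (N : ℕ) :
    detCompress (toeplitz w) (finiteModelSpace α m N) =
      ∏ j ∈ Finset.range N, (coSeries w (conj (α j : ℂ))).det := by
  induction N with
  | zero =>
    refine detCompress_eq_one fun x hx => ?_
    have hx_zero : x = 0 := by
      simpa [finiteModelSpace, modelSpace_partialBlaschke_zero] using hx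
    rw [hx_zero, map_zero]
  | succ N ih =>
    have horth := isOrtho_modelSpace_range_takenakaMap (m := m) α N
    rw [Finset.prod_range_succ, ← ih, ← detCompress_toeplitz_range_takenakaMap α hw hco]
    refine detCompress_sup (modelSpace_partialBlaschke_succ α N) horth fun x hx y hy => ?_
    exact Submodule.isOrtho_iff_inner_eq.mp horth.symm y hy _
      (toeplitz_mem_modelSpace α (preservesH2Compl_of_isCoanalytic hco) hx)

end FiniteBlaschke

/-! ### Continuous logarithms and geometric means -/

section Logarithm

lemma differentiableAt_of_exp_comp {F L : ℂ → ℂ} {z : ℂ} (hF : DifferentiableAt ℂ F z)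
    (hL : ContinuousAt L z) (hexp : ∀ᶠ y in 𝓝 z, Complex.exp (L y) = F y) :
    DifferentiableAt ℂ L z := by
  have hz : Complex.exp (L z) = F z := hexp.self_of_nhds
  have hlog : DifferentiableAt ℂ (fun y => L z + Complex.log (F y / F z)) z := by
    refine (DifferentiableAt.clog (hF.div_const _) ?_).const_add _
    rw [div_self (hz ▸ Complex.exp_ne_zero _)]
    exact one_mem_slitPlane
  have him : Tendsto (fun y => (L y - L z).im) (𝓝 z) (𝓝 0) := by
    simpa [Function.comp_def] using
      continuous_im.continuousAt.tendsto.comp (hL.tendsto.sub_const (L z))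
  refine hlog.congr_of_eventuallyEq ?_
  filter_upwards [hexp, him.eventually (Ioo_mem_nhds (neg_lt_zero.mpr Real.pi_pos) Real.pi_pos)]
    with y hy hy_im
  rw [← hy, ← hz, ← Complex.exp_sub, Complex.log_exp hy_im.1 hy_im.2.le, add_sub_cancel]

lemma exists_continuousOn_exp_eq {F : ℂ → ℂ} (hF : ContinuousOn F (Metric.closedBall 0 1))
    (hF₀ : ∀ z ∈ Metric.closedBall (0 : ℂ) 1, F z ≠ 0) :
    ∃ L : ℂ → ℂ, ContinuousOn L (Metric.closedBall 0 1) ∧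
      ∀ z ∈ Metric.closedBall (0 : ℂ) 1, Complex.exp (L z) = F z := by
  -- The radial retraction onto the closed disk extends `F` to a nonvanishing function on `ℂ`.
  let r : ℂ → ℂ := fun z => z / (max 1 ‖z‖ : ℝ)
  have hpos : ∀ z : ℂ, (0 : ℝ) < max 1 ‖z‖ := fun z => lt_max_of_lt_left one_pos
  have hr_mem : ∀ z, r z ∈ Metric.closedBall (0 : ℂ) 1 := fun z => by
    rw [mem_closedBall_zero_iff, norm_div, Complex.norm_real, Real.norm_of_nonneg (hpos z).le,
      div_le_one (hpos z)]
    exact le_max_right _ _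
  have hr_cont : Continuous r :=
    continuous_id.div (by fun_prop) fun z => Complex.ofReal_ne_zero.mpr (hpos z).ne'
  have hr_eq : ∀ z ∈ Metric.closedBall (0 : ℂ) 1, r z = z := fun z hz => by
    simp [r, max_eq_left (mem_closedBall_zero_iff.mp hz)]
  obtain ⟨L, ⟨-, hL⟩, -⟩ := isCoveringMapOn_exp.existsUnique_continuousMap_lifts
    (⟨fun z => F (r z), hF.comp_continuous hr_cont hr_mem⟩ : C(ℂ, ℂ)) (a₀ := 0)
    (exp_log (hF₀ _ (hr_mem 0))) fun z => hF₀ _ (hr_mem z)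
  exact ⟨L, L.continuous.continuousOn, fun z hz =>
    (congrFun hL z).trans (congrArg F (hr_eq z hz))⟩

lemma exists_diffContOnCl_exp_eq {F : ℂ → ℂ} (hF : DiffContOnCl ℂ F (Metric.ball 0 1))
    (hF₀ : ∀ z ∈ Metric.closedBall (0 : ℂ) 1, F z ≠ 0) :
    ∃ L : ℂ → ℂ, DiffContOnCl ℂ L (Metric.ball 0 1) ∧
      ∀ z ∈ Metric.closedBall (0 : ℂ) 1, Complex.exp (L z) = F z := by
  obtain ⟨L, hL, hexp⟩ := exists_continuousOn_exp_eq hF.continuousOn_ball hF₀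
  refine ⟨L, DiffContOnCl.mk_ball (fun z hz => ?_) hL, hexp⟩
  have hnhds : Metric.ball (0 : ℂ) 1 ∈ 𝓝 z := Metric.isOpen_ball.mem_nhds hz
  refine (differentiableAt_of_exp_comp (hF.differentiableAt Metric.isOpen_ball hz)
    (hL.continuousAt (mem_of_superset hnhds Metric.ball_subset_closedBall)) ?_)
      |>.differentiableWithinAt
  filter_upwards [hnhds] with y hy using hexp y (Metric.ball_subset_closedBall hy)

lemma normSq_one_add_mul_sub_normSq (β s : ℂ) :
    ‖1 + β * s‖ ^ 2 - ‖s + conj β‖ ^ 2 = (1 - ‖β‖ ^ 2) * (1 - ‖s‖ ^ 2) := by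
  simp only [← Complex.normSq_eq_norm_sq, Complex.normSq_apply, Complex.add_re, Complex.add_im,
    Complex.mul_re, Complex.mul_im, Complex.conj_re, Complex.conj_im, Complex.one_re,
    Complex.one_im]
  ring

lemma one_add_mul_ne_zero (β : 𝔻) {s : ℂ} (hs : ‖s‖ ≤ 1) : 1 + (β : ℂ) * s ≠ 0 := by
  intro h
  have hnorm : ‖(β : ℂ) * s‖ = 1 := by
    rw [eq_neg_of_add_eq_zero_right h, norm_neg, norm_one]
  rw [norm_mul] at hnorm
  nlinarith [norm_nonneg (β : ℂ), norm_nonneg s, β.norm_lt_one]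

lemma norm_add_conj_div_lt_one (β : 𝔻) {s : ℂ} (hs : ‖s‖ < 1) :
    ‖(s + conj (β : ℂ)) / (1 + β * s)‖ < 1 := by
  rw [norm_div, div_lt_one (norm_pos_iff.mpr (one_add_mul_ne_zero β hs.le))]
  have hpos : 0 < (1 - ‖(β : ℂ)‖ ^ 2) * (1 - ‖s‖ ^ 2) :=
    mul_pos (by nlinarith [norm_nonneg (β : ℂ), β.norm_lt_one]) (by nlinarith [norm_nonneg s])
  rw [← normSq_one_add_mul_sub_normSq] at hpos
  exact lt_of_pow_lt_pow_left₀ 2 (norm_nonneg _) (sub_pos.mp hpos)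

lemma conj_mobius_neg (β : 𝔻) (t : Circle) :
    conj (mobius (-β) t : ℂ) = ((t : ℂ)⁻¹ + conj (β : ℂ)) / (1 + β * (t : ℂ)⁻¹) := by
  have hmob : (mobius (-β) t : ℂ) = ((t : ℂ) - (-β : 𝔻)) / (1 - conj ((-β : 𝔻) : ℂ) * t) := rfl
  rw [hmob, ← Circle.coe_inv, Circle.coe_inv_eq_conj]
  simp

/-- The mean of a continuous function with respect to the normalized arc length of the unit
circle, written as in the definition of `geomMean`. -/
def circleMean (f : C(Circle, ℂ)) : ℂ :=
  ((1 / (2 * Real.pi) : ℝ) : ℂ) * ∫ θ in (0 : ℝ)..(2 * Real.pi), f (Circle.exp θ)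

lemma circleMean_add (f g : C(Circle, ℂ)) : circleMean (f + g) = circleMean f + circleMean g := by
  simp only [circleMean, ContinuousMap.add_apply]
  rw [intervalIntegral.integral_add (Continuous.intervalIntegrable (by fun_prop) _ _)
    (Continuous.intervalIntegrable (by fun_prop) _ _), mul_add]

lemma circleMean_const (c : ℂ) : circleMean (ContinuousMap.const Circle c) = c := by
  have hpi : (Real.pi : ℂ) ≠ 0 := Complex.ofReal_ne_zero.mpr Real.pi_ne_zero
  simp only [circleMean, one_div, mul_inv_rev, ofReal_mul, ofReal_inv, ofReal_ofNat,
    ContinuousMap.const_apply, intervalIntegral.integral_const, sub_zero, real_smul]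
  field_simp

lemma circleMean_star (f : C(Circle, ℂ)) : circleMean (star f) = conj (circleMean f) := by
  simp only [circleMean, ContinuousMap.star_apply, map_mul, Complex.conj_ofReal]
  rw [intervalIntegral.integral_of_le Real.two_pi_pos.le,
    intervalIntegral.integral_of_le Real.two_pi_pos.le, ← integral_conj]
  rfl

lemma circleMean_eq_of_diffContOnCl {L : ℂ → ℂ} (hL : DiffContOnCl ℂ L (Metric.ball 0 1)) (β : 𝔻)
    {ℓ : C(Circle, ℂ)} (hℓ : ∀ t, ℓ t = L (conj (mobius (-β) t : ℂ))) :
    circleMean ℓ = L (conj (β : ℂ)) := by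
  let ψ : ℂ → ℂ := fun s => (s + conj (β : ℂ)) / (1 + β * s)
  have hψ : DiffContOnCl ℂ ψ (Metric.ball 0 1) := by
    refine (DifferentiableOn.div (by fun_prop) (by fun_prop) fun s hs => ?_).diffContOnCl
    rw [closure_ball _ one_ne_zero, mem_closedBall_zero_iff] at hs
    exact one_add_mul_ne_zero β hs
  have hLψ : DiffContOnCl ℂ (L ∘ ψ) (Metric.ball 0 |1|) := by
    rw [abs_one]
    exact hL.comp hψ fun s hs =>
      mem_ball_zero_iff.mpr (norm_add_conj_div_lt_one β (mem_ball_zero_iff.mp hs))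
  calc circleMean ℓ = Real.circleAverage (fun s => (L ∘ ψ) s⁻¹) 0 1 := by
        simp only [circleMean, Real.circleAverage, hℓ, conj_mobius_neg, circleMap_zero,
          Circle.coe_exp, Complex.real_smul, one_div, Function.comp_apply, ψ,
          Complex.ofReal_one, one_mul]
    _ = (L ∘ ψ) 0 := by rw [Real.circleAverage_zero_one_congr_inv, hLψ.circleAverage]
    _ = L (conj (β : ℂ)) := by simp [ψ]

variable {m : ℕ}

lemma exists_const_of_isLogDet {φ : Symbol m} {ℓ ℓ' : C(Circle, ℂ)} (hℓ : IsLogDet φ ℓ)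
    (hℓ' : IsLogDet φ ℓ') : ∃ c, Complex.exp c = 1 ∧ ℓ' = ℓ + ContinuousMap.const Circle c := by
  have hone : ∀ t, Complex.exp (ℓ' t - ℓ t) = 1 := fun t => by
    rw [Complex.exp_sub, hℓ' t, ← hℓ t, div_self (Complex.exp_ne_zero _)]
  have hconst : ∀ t, ℓ' t - ℓ t = ℓ' 1 - ℓ 1 := fun t =>
    isCoveringMap_exp.const_of_comp (g := fun t : Circle => ℓ' t - ℓ t) (by fun_prop)
      (fun s t => Subtype.ext ((hone s).trans (hone t).symm)) t 1
  refine ⟨ℓ' 1 - ℓ 1, hone 1, ContinuousMap.ext fun t => ?_⟩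
  rw [ContinuousMap.add_apply, ContinuousMap.const_apply, ← hconst t, add_sub_cancel]

lemma geomMean_eq_exp_circleMean {φ : Symbol m} {ℓ : C(Circle, ℂ)} (hℓ : IsLogDet φ ℓ) :
    geomMean φ = Complex.exp (circleMean ℓ) := by
  have hex : ∃ ℓ : C(Circle, ℂ), IsLogDet φ ℓ := ⟨ℓ, hℓ⟩
  obtain ⟨c, hc, heq⟩ := exists_const_of_isLogDet hℓ hex.choose_spec
  rw [geomMean, dif_pos hex]
  change Complex.exp (circleMean hex.choose) = _
  rw [heq, circleMean_add, circleMean_const, Complex.exp_add, hc, mul_one]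

lemma isLogDet_mul {φ χ : Symbol m} {ℓ ℓ' : C(Circle, ℂ)} (hφ : IsLogDet φ ℓ)
    (hχ : IsLogDet χ ℓ') : IsLogDet (φ * χ) (ℓ + ℓ') := fun t => by
  rw [ContinuousMap.add_apply, Complex.exp_add, hφ t, hχ t, ContinuousMap.mul_apply,
    Matrix.det_mul]

lemma isLogDet_star {φ : Symbol m} {ℓ : C(Circle, ℂ)} (hφ : IsLogDet φ ℓ) :
    IsLogDet (star φ) (star ℓ) := fun t => by
  rw [ContinuousMap.star_apply, ContinuousMap.star_apply, Matrix.star_eq_conjTranspose,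
    Matrix.det_conjTranspose, ← hφ t, ← starRingEnd_apply, ← starRingEnd_apply, Complex.exp_conj]

lemma geomMean_mul {φ χ : Symbol m} {ℓ ℓ' : C(Circle, ℂ)} (hφ : IsLogDet φ ℓ)
    (hχ : IsLogDet χ ℓ') : geomMean (φ * χ) = geomMean φ * geomMean χ := by
  rw [geomMean_eq_exp_circleMean (isLogDet_mul hφ hχ), geomMean_eq_exp_circleMean hφ,
    geomMean_eq_exp_circleMean hχ, circleMean_add, Complex.exp_add]

lemma geomMean_star {φ : Symbol m} {ℓ : C(Circle, ℂ)} (hφ : IsLogDet φ ℓ) :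
    geomMean (star φ) = conj (geomMean φ) := by
  rw [geomMean_eq_exp_circleMean (isLogDet_star hφ), geomMean_eq_exp_circleMean hφ,
    circleMean_star, Complex.exp_conj]

end Logarithm

section CoSeries

variable {m : ℕ}

lemma diffContOnCl_coSeries {w : Symbol m} (hw : Summable fun n : ℤ => ‖w.coeff n‖) :
    DiffContOnCl ℂ (coSeries w) (Metric.ball 0 1) := by
  have hbound : ∀ (n : ℕ) (z : ℂ), z ∈ Metric.closedBall (0 : ℂ) 1 →
      ‖z ^ n • w.coeff (-(n : ℤ))‖ ≤ ‖w.coeff (-(n : ℤ))‖ := fun n z hz => by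
    rw [norm_smul, norm_pow]
    exact mul_le_of_le_one_left (norm_nonneg _)
      (pow_le_one₀ (norm_nonneg _) (mem_closedBall_zero_iff.mp hz))
  exact DiffContOnCl.mk_ball
    (differentiableOn_tsum_of_summable_norm (summable_norm_coeff_neg hw) (fun n => by fun_prop)
      Metric.isOpen_ball fun n z hz => hbound n z (Metric.ball_subset_closedBall hz))
    (continuousOn_tsum (fun n => by fun_prop) (summable_norm_coeff_neg hw) hbound)

lemma diffContOnCl_det_coSeries {w : Symbol m} (hw : Summable fun n : ℤ => ‖w.coeff n‖) :
    DiffContOnCl ℂ (fun z => (coSeries w z).det) (Metric.ball 0 1) := by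
  have hdet : Differentiable ℂ fun M : Matrix (Fin m) (Fin m) ℂ => M.det := by
    have (i j : Fin m) : Differentiable ℂ fun M : Matrix (Fin m) (Fin m) ℂ => M i j :=
      (Matrix.entryLinearMap ℂ ℂ i j).toContinuousLinearMap.differentiable
    simp only [Matrix.det_apply]
    fun_prop
  exact hdet.comp_diffContOnCl (diffContOnCl_coSeries hw)

lemma coeff_apply (a : Symbol m) (n : ℤ) (i j : Fin m) :
    a.coeff n i j = fourierCoeff (fun θ : Angle => a θ.toCircle i j) n := by
  let L : Matrix (Fin m) (Fin m) ℂ →L[ℂ] ℂ :=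
    LinearMap.toContinuousLinearMap (Matrix.entryLinearMap ℂ ℂ i j)
  refine (ContinuousLinearMap.integral_comp_comm L
    (φ := fun θ : Angle => (fourier (-n) θ : ℂ) • a θ.toCircle) ?_).symm
  exact ((fourier (-n)).continuous.smul (a.continuous.comp AddCircle.continuous_toCircle))
    |>.integrable_of_hasCompactSupport (HasCompactSupport.of_compactSpace _)

lemma hasSum_fourier_coeff_apply {w : Symbol m} (hw : Summable fun n : ℤ => ‖w.coeff n‖)
    (θ : Angle) (i j : Fin m) :
    HasSum (fun n : ℤ => w.coeff n i j • fourier n θ) (w θ.toCircle i j) := by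
  let f : C(Angle, ℂ) := ⟨fun θ => w θ.toCircle i j,
    (w.continuous.comp AddCircle.continuous_toCircle).matrix_elem i j⟩
  have hcoeff : ∀ n, fourierCoeff f n = w.coeff n i j := fun n => (coeff_apply w n i j).symm
  have hf : Summable (fourierCoeff f) := Summable.of_norm_bounded hw fun n => by
    rw [hcoeff]
    exact Matrix.norm_entry_le_entrywise_sup_norm _
  simp only [← hcoeff]
  exact has_pointwise_sum_fourier_series_of_summable hf θ

lemma coSeries_conj_circle {w : Symbol m} (hw : Summable fun n : ℤ => ‖w.coeff n‖)
    (hco : w.IsCoanalytic) (t : Circle) : coSeries w (conj (t : ℂ)) = w t := by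
  obtain ⟨θ, rfl⟩ : ∃ θ : Angle, θ.toCircle = t := by
    obtain ⟨θ, hθ⟩ := (AddCircle.homeomorphCircle Real.two_pi_pos.ne').surjective t
    exact ⟨θ, by rw [← hθ, AddCircle.homeomorphCircle_apply]⟩
  ext i j
  have hinj : Function.Injective fun n : ℕ => -(n : ℤ) := fun a b h => by simpa using h
  have hfourier := hasSum_fourier_coeff_apply hw θ i j
  rw [← hinj.hasSum_iff fun n hn => ?_] at hfourier
  · refine ((hasSum_coSeries hw ?_).map (Matrix.entryLinearMap ℂ ℂ i j)
      (LinearMap.continuous_of_finiteDimensional _)).unique (hfourier.congr_fun fun n => ?_)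
    · rw [RCLike.norm_conj, Circle.norm_coe]
    · simp [fourier_apply, AddCircle.toCircle_zsmul, mul_comm, ← Circle.coe_inv_eq_conj]
  · have hpos : 0 < n := by
      by_contra hn₀
      exact hn ⟨(-n).toNat, by simp only; omega⟩
    rw [hco n hpos, Matrix.zero_apply, zero_smul]

lemma det_coSeries_ne_zero {w w' : Symbol m} (hw : Summable fun n : ℤ => ‖w.coeff n‖)
    (hco : w.IsCoanalytic) (hw' : Summable fun n : ℤ => ‖w'.coeff n‖)
    (hco' : w'.IsCoanalytic) (h : w * w' = 1) {z : ℂ} (hz : ‖z‖ ≤ 1) :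
    (coSeries w z).det ≠ 0 := by
  have hmul : coSeries w z * coSeries w' z = 1 := by
    rcases hz.lt_or_eq with hz | hz
    · exact coSeries_mul_coSeries hw hco hw' hco' h hz
    · obtain ⟨t, rfl⟩ : ∃ t : Circle, conj (t : ℂ) = z :=
        ⟨⟨conj z, mem_sphere_zero_iff_norm.mpr (by rw [RCLike.norm_conj, hz])⟩, conj_conj z⟩
      rw [coSeries_conj_circle hw hco, coSeries_conj_circle hw' hco', ← ContinuousMap.mul_apply,
        h, ContinuousMap.one_apply]
  exact (IsUnit.of_mul_eq_one _ (by rw [← Matrix.det_mul, hmul, Matrix.det_one])).ne_zero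

lemma exists_isLogDet_comp_mobius {w w' : Symbol m} (hw : Summable fun n : ℤ => ‖w.coeff n‖)
    (hco : w.IsCoanalytic) (hw' : Summable fun n : ℤ => ‖w'.coeff n‖)
    (hco' : w'.IsCoanalytic) (h : w * w' = 1) (β : 𝔻) :
    ∃ ℓ, IsLogDet (w.comp (mobius (-β))) ℓ ∧
      geomMean (w.comp (mobius (-β))) = (coSeries w (conj (β : ℂ))).det := by
  obtain ⟨L, hL, hexp⟩ := exists_diffContOnCl_exp_eq (diffContOnCl_det_coSeries hw) fun z hz =>
    det_coSeries_ne_zero hw hco hw' hco' h (mem_closedBall_zero_iff.mp hz)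
  have hcirc : ∀ t : Circle, conj (t : ℂ) ∈ Metric.closedBall (0 : ℂ) 1 := fun t => by
    rw [mem_closedBall_zero_iff, RCLike.norm_conj, Circle.norm_coe]
  let ℓ : C(Circle, ℂ) := ⟨fun t => L (conj (mobius (-β) t : ℂ)),
    hL.continuousOn_ball.comp_continuous
      (continuous_conj.comp (continuous_subtype_val.comp (mobius (-β)).continuous))
      fun t => hcirc _⟩
  have hℓ : IsLogDet (w.comp (mobius (-β))) ℓ := fun t =>
    (hexp _ (hcirc _)).trans (congrArg Matrix.det (coSeries_conj_circle hw hco _))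
  refine ⟨ℓ, hℓ, ?_⟩
  rw [geomMean_eq_exp_circleMean hℓ, circleMean_eq_of_diffContOnCl hL β fun _ => rfl]
  refine hexp _ (mem_closedBall_zero_iff.mpr ?_)
  rw [RCLike.norm_conj]
  exact β.norm_lt_one.le

end CoSeries

/-! ### Convergence of Blaschke products -/

section BlaschkeConvergence

lemma blaschkeFactor_sub_one {β : 𝔻} (hβ : β ≠ 0) (z : 𝔻) :
    blaschkeFactor β z - 1 = -((1 - (‖(β : ℂ)‖ : ℂ)) *
      (((‖(β : ℂ)‖ : ℂ) + conj (β : ℂ) * z) / ((‖(β : ℂ)‖ : ℂ) * (1 - conj (β : ℂ) * z)))) := by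
  have hnorm : (‖(β : ℂ)‖ : ℂ) ≠ 0 := by simpa using hβ
  rw [blaschkeFactor, if_neg hβ, div_mul_div_comm, mul_div_assoc', ← neg_div, sub_eq_iff_eq_add,
    div_add_one (mul_ne_zero hnorm (one_sub_conj_mul_ne_zero β z))]
  congr 1
  linear_combination RCLike.conj_mul (β : ℂ)

lemma norm_blaschkeFactor_sub_one_le (β z : 𝔻) :
    ‖blaschkeFactor β z - 1‖ ≤ (1 - ‖(β : ℂ)‖) * ((1 + ‖(z : ℂ)‖) / (1 - ‖(z : ℂ)‖)) := by
  have hz := sub_pos.mpr z.norm_lt_one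
  have hβ := sub_pos.mpr β.norm_lt_one
  rcases eq_or_ne β 0 with rfl | hβ₀
  · rw [UnitDisc.coe_zero, norm_zero, sub_zero, one_mul, le_div_iff₀ hz, blaschkeFactor,
      if_pos rfl]
    have htri : ‖(z : ℂ) - 1‖ ≤ ‖(z : ℂ)‖ + 1 := (norm_sub_le _ _).trans (by simp)
    nlinarith [norm_nonneg ((z : ℂ) - 1), norm_nonneg (z : ℂ)]
  have hβ_pos : 0 < ‖(β : ℂ)‖ := by simpa using hβ₀
  have hnum : ‖(‖(β : ℂ)‖ : ℂ) + conj (β : ℂ) * z‖ ≤ ‖(β : ℂ)‖ * (1 + ‖(z : ℂ)‖) := by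
    refine (norm_add_le _ _).trans (le_of_eq ?_)
    rw [norm_mul, RCLike.norm_conj, Complex.norm_real, norm_norm]
    ring
  have hden : ‖(β : ℂ)‖ * (1 - ‖(z : ℂ)‖) ≤ ‖(‖(β : ℂ)‖ : ℂ) * (1 - conj (β : ℂ) * z)‖ := by
    have htri := norm_sub_norm_le (1 : ℂ) (conj (β : ℂ) * z)
    rw [norm_one, norm_mul, RCLike.norm_conj] at htri
    rw [norm_mul, Complex.norm_real, norm_norm]
    gcongr
    nlinarith [norm_nonneg (z : ℂ)]
  have hsub : ‖(1 : ℂ) - (‖(β : ℂ)‖ : ℂ)‖ = 1 - ‖(β : ℂ)‖ := by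
    rw [← Complex.ofReal_one, ← Complex.ofReal_sub, Complex.norm_real, Real.norm_of_nonneg hβ.le]
  rw [blaschkeFactor_sub_one hβ₀, norm_neg, norm_mul, hsub, norm_div,
    ← mul_div_mul_left (1 + ‖(z : ℂ)‖) _ hβ_pos.ne']
  gcongr

variable {α : ℕ → 𝔻}

lemma multipliable_blaschkeFactor (hα : Summable fun j => 1 - ‖(α j : ℂ)‖) (z : 𝔻) :
    Multipliable fun j => blaschkeFactor (α j) z := by
  simpa using multipliable_one_add_of_summable (f := fun j => blaschkeFactor (α j) z - 1)
    ((hα.mul_right _).of_nonneg_of_le (fun _ => norm_nonneg _)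
      fun j => norm_blaschkeFactor_sub_one_le (α j) z)

lemma tendsto_partialBlaschke (hα : Summable fun j => 1 - ‖(α j : ℂ)‖) (z : 𝔻) :
    Tendsto (fun N => partialBlaschke α N z) atTop (𝓝 (infiniteBlaschke α z)) :=
  (multipliable_blaschkeFactor hα z).hasProd.tendsto_prod_nat

lemma norm_blaschkeFactor_sq_le (β z : 𝔻) :
    ‖blaschkeFactor β z‖ ^ 2 ≤ Real.exp (-((1 - ‖(z : ℂ)‖ ^ 2) / 4 * (1 - ‖(β : ℂ)‖))) := by
  have hz := z.norm_lt_one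
  have hβ := β.norm_lt_one
  have hz₀ := norm_nonneg (z : ℂ)
  have hβ₀ := norm_nonneg (β : ℂ)
  have hden_pos := norm_pos_iff.mpr (one_sub_conj_mul_ne_zero β z)
  have hden_le : ‖1 - conj (β : ℂ) * z‖ ≤ 2 := by
    refine (norm_sub_le _ _).trans ?_
    rw [norm_one, norm_mul, RCLike.norm_conj]
    nlinarith
  have hsub := normSq_one_add_mul_sub_normSq (-conj (β : ℂ)) z
  simp only [map_neg, Complex.conj_conj, norm_neg, RCLike.norm_conj, neg_mul,
    ← sub_eq_add_neg] at hsub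
  have hlower : (1 - ‖(z : ℂ)‖ ^ 2) * (1 - ‖(β : ℂ)‖) ≤
      (1 - ‖(β : ℂ)‖ ^ 2) * (1 - ‖(z : ℂ)‖ ^ 2) := by
    rw [mul_comm]
    exact mul_le_mul_of_nonneg_right (by nlinarith) (by nlinarith)
  have hnonneg : 0 ≤ (1 - ‖(z : ℂ)‖ ^ 2) * (1 - ‖(β : ℂ)‖) :=
    mul_nonneg (by nlinarith) (by linarith)
  rw [blaschkeFactor_eq, norm_mul, norm_blaschkeConst, one_mul, norm_div, div_pow]
  refine le_trans ?_ (Real.add_one_le_exp _)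
  rw [div_le_iff₀ (by positivity)]
  nlinarith [mul_le_mul hden_le hden_le hden_pos.le zero_le_two]

lemma tendsto_partialBlaschke_zero (hα : ¬ Summable fun j => 1 - ‖(α j : ℂ)‖) (z : 𝔻) :
    Tendsto (fun N => partialBlaschke α N z) atTop (𝓝 0) := by
  set c := (1 - ‖(z : ℂ)‖ ^ 2) / 4 with hc
  have hc_pos : 0 < c := by nlinarith [z.norm_lt_one, norm_nonneg (z : ℂ)]
  have hsum : Tendsto (fun N => ∑ j ∈ Finset.range N, (1 - ‖(α j : ℂ)‖)) atTop atTop :=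
    (not_summable_iff_tendsto_nat_atTop_of_nonneg
      fun j => sub_nonneg.mpr (α j).norm_lt_one.le).mp hα
  have hbound (N : ℕ) : ‖partialBlaschke α N z‖ ^ 2 ≤
      Real.exp (-(c * ∑ j ∈ Finset.range N, (1 - ‖(α j : ℂ)‖))) := by
    rw [partialBlaschke, norm_prod, ← Finset.prod_pow, Finset.mul_sum, ← Finset.sum_neg_distrib,
      Real.exp_sum]
    exact Finset.prod_le_prod (fun j _ => by positivity)
      fun j _ => norm_blaschkeFactor_sq_le (α j) z
  have hsq : Tendsto (fun N => ‖partialBlaschke α N z‖ ^ 2) atTop (𝓝 0) :=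
    squeeze_zero (fun N => by positivity) hbound
      (Real.tendsto_exp_neg_atTop_nhds_zero.comp (hsum.const_mul_atTop hc_pos))
  rw [tendsto_zero_iff_norm_tendsto_zero]
  simpa using hsq.sqrt

lemma partialBlaschke_add (α : ℕ → 𝔻) (N M : ℕ) (z : 𝔻) :
    partialBlaschke α (N + M) z =
      partialBlaschke α N z * partialBlaschke (fun j => α (N + j)) M z :=
  Finset.prod_range_add _ _ _

end BlaschkeConvergence

/-! ### Strong convergence of the projections -/

section Projections

lemma tendsto_one_sub_starProjection {E : Type*} [NormedAddCommGroup E]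
    [InnerProductSpace ℂ E] [CompleteSpace E] (K : ℕ → Submodule ℂ E)
    [∀ N, (K N).HasOrthogonalProjection] (hK : Monotone K) {V : Submodule ℂ E}
    (hV : ⨅ N, (K N)ᗮ = V) (f : E) :
    Tendsto (fun N => (1 - (K N).starProjection) f) atTop (𝓝 ((1 - Vᗮ.starProjection) f)) := by
  have hclosure : (⨆ N, K N).topologicalClosure = Vᗮ := by
    rw [← Submodule.orthogonal_orthogonal_eq_closure, ← Submodule.iInf_orthogonal, hV]
  have hlim := Submodule.starProjection_tendsto_closure_iSup K hK f
  simp only [hclosure] at hlim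
  exact tendsto_const_nhds.sub hlim

lemma exists_tendsto_inner_hyperfilter {E : Type*} [NormedAddCommGroup E]
    [InnerProductSpace ℂ E] [CompleteSpace E] {g : ℕ → E} {C : ℝ} (hg : ∀ N, ‖g N‖ ≤ C) :
    ∃ g₀ : E, ∀ y, Tendsto (fun N => inner ℂ y (g N)) (hyperfilter ℕ) (𝓝 (inner ℂ y g₀)) := by
  let φ : ℕ → WeakDual ℂ E := fun N => StrongDual.toWeakDual (InnerProductSpace.toDual ℂ E (g N))
  have hmem (N : ℕ) :
      φ N ∈ WeakDual.toStrongDual ⁻¹' Metric.closedBall (0 : StrongDual ℂ E) C := by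
    rw [Set.mem_preimage, mem_closedBall_zero_iff]
    exact ((InnerProductSpace.toDual ℂ E).norm_map (g N)).le.trans (hg N)
  obtain ⟨ψ, -, hψ⟩ := (WeakDual.isCompact_closedBall (𝕜 := ℂ) (E := E) 0 C).ultrafilter_le_nhds'
    ((hyperfilter ℕ).map φ) (by rw [Ultrafilter.mem_map]; exact Filter.univ_mem' hmem)
  refine ⟨(InnerProductSpace.toDual ℂ E).symm (WeakDual.toStrongDual ψ), fun y => ?_⟩
  have hlim : Tendsto (fun N => inner ℂ (g N) y) (hyperfilter ℕ)
      (𝓝 (WeakDual.toStrongDual ψ y)) :=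
    ((WeakDual.eval_continuous y).tendsto ψ).comp hψ
  rw [← inner_conj_symm, InnerProductSpace.toDual_symm_apply]
  simpa only [Function.comp_def, inner_conj_symm] using (continuous_conj.tendsto _).comp hlim

variable {m : ℕ} (α : ℕ → 𝔻)

lemma exists_tendsto_inner_diskValue_hyperfilter {g : ℕ → H2 m} {C : ℝ} (hg : ∀ N, ‖g N‖ ≤ C) :
    ∃ g₀ : H2 m, ∀ (z : 𝔻) (x : Vec m), Tendsto (fun N => inner ℂ x (diskValue (g N) z))
      (hyperfilter ℕ) (𝓝 (inner ℂ x (diskValue g₀ z))) := by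
  obtain ⟨g₀, hg₀⟩ := exists_tendsto_inner_hyperfilter hg
  refine ⟨g₀, fun z x => ?_⟩
  simpa only [inner_kernel_left] using hg₀ (kernel z x)

lemma norm_toeplitz_partialSymbol (N : ℕ) (g : H2 m) :
    ‖toeplitz (partialSymbol m α N) g‖ = ‖g‖ := by
  refine (ContinuousLinearMap.norm_map_iff_adjoint_comp_self _).mpr ?_ g
  ext1 f
  rw [adjoint_toeplitz]
  exact toeplitz_star_partialSymbol_toeplitz α N f

lemma orthogonal_modelSpace_partialBlaschke (N : ℕ) :
    (modelSpace m (partialBlaschke α N))ᗮ = mulH2 m (partialBlaschke α N) := by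
  have hrange : (mulH2 m (partialBlaschke α N) : Set (H2 m)) =
      Set.range (toeplitz (partialSymbol m α N)) :=
    Set.ext fun _ => mem_mulH2_partialBlaschke_iff α
  have hclosed : IsClosed (mulH2 m (partialBlaschke α N) : Set (H2 m)) := by
    rw [hrange]
    exact (AddMonoidHomClass.isometry_of_norm _
      (norm_toeplitz_partialSymbol α N)).isClosedEmbedding.isClosed_range
  rw [modelSpace, Submodule.orthogonal_orthogonal_eq_closure,
    hclosed.submodule_topologicalClosure_eq]

lemma monotone_modelSpace_partialBlaschke :
    Monotone fun N => modelSpace m (partialBlaschke α N) :=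
  monotone_nat_of_le_succ fun N => by
    rw [modelSpace_partialBlaschke_succ]
    exact le_sup_left

variable {α} {u : 𝔻 → ℂ}

-- For `f ∈ ⋂ u_N H²`, the quotient `f / u` is a weak limit of the quotients `f / u_N`.
lemma iInf_mulH2_partialBlaschke_le
    (hu : ∀ z, Tendsto (fun N => partialBlaschke α N z) atTop (𝓝 (u z))) :
    ⨅ N, mulH2 m (partialBlaschke α N) ≤ mulH2 m u := by
  intro f hf
  rw [Submodule.mem_iInf] at hf
  choose g hg using fun N => (mem_mulH2_partialBlaschke_iff α).mp (hf N)
  obtain ⟨g₀, hg₀⟩ := exists_tendsto_inner_diskValue_hyperfilter (g := g) (C := ‖f‖) fun N => by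
    rw [← norm_toeplitz_partialSymbol α N (g N), hg N]
  refine ⟨g₀, fun z => ext_inner_left ℂ fun x => ?_⟩
  rw [inner_smul_right]
  refine tendsto_nhds_unique (tendsto_const_nhds.congr fun N => ?_)
    (((hu z).mono_left Nat.hyperfilter_le_atTop).mul (hg₀ z x))
  rw [← inner_smul_right, ← diskValue_toeplitz_partialSymbol, hg N]

-- `u / u_N` is the limit of the tails `u_{N+M} / u_N`, which act as isometries on `H²`.
lemma mulH2_le_mulH2_partialBlaschke
    (hu : ∀ z, Tendsto (fun N => partialBlaschke α N z) atTop (𝓝 (u z))) (N : ℕ) :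
    mulH2 m u ≤ mulH2 m (partialBlaschke α N) := by
  rintro f ⟨g, hg⟩
  obtain ⟨h, hh⟩ := exists_tendsto_inner_diskValue_hyperfilter (C := ‖g‖)
    (g := fun M => toeplitz (partialSymbol m (fun j => α (N + j)) M) g)
    fun M => (norm_toeplitz_partialSymbol _ M g).le
  refine ⟨h, fun z => ext_inner_left ℂ fun x => ?_⟩
  rw [hg z, inner_smul_right, inner_smul_right]
  have hshift : Tendsto (fun M => partialBlaschke α (N + M) z) (hyperfilter ℕ) (𝓝 (u z)) :=
    ((hu z).comp (tendsto_add_atTop_nat N |>.congr fun M => add_comm M N)).mono_left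
      Nat.hyperfilter_le_atTop
  refine tendsto_nhds_unique (hshift.mul_const _) (((hh z x).const_mul _).congr fun M => ?_)
  rw [diskValue_toeplitz_partialSymbol, inner_smul_right, partialBlaschke_add, mul_assoc]

-- With `u = 0` this is the divergent case, where `Q_u = 0`.
lemma tendsto_projQ (hu : ∀ z, Tendsto (fun N => partialBlaschke α N z) atTop (𝓝 (u z)))
    (f : H2 m) :
    Tendsto (fun N => projQ m (partialBlaschke α N) f) atTop (𝓝 (projQ m u f)) := by
  refine tendsto_one_sub_starProjection _ (monotone_modelSpace_partialBlaschke α) ?_ f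
  simp only [orthogonal_modelSpace_partialBlaschke]
  exact le_antisymm (iInf_mulH2_partialBlaschke_le hu)
    (le_iInf (mulH2_le_mulH2_partialBlaschke hu))

lemma projQ_eq_starProjection (m : ℕ) (u : 𝔻 → ℂ) :
    projQ m u = (modelSpace m u)ᗮ.starProjection :=
  (modelSpace m u).starProjection_orthogonal'.symm

lemma projQ_zero (m : ℕ) : projQ m (fun _ => 0) = 0 := by
  ext1 f
  have hf : f ∈ modelSpace m (fun _ => 0) := by
    rintro g ⟨h, hg⟩
    have hzero : g = 0 :=
      ext_diskValue fun z => by rw [hg z, zero_smul, ← diskEval_apply, map_zero]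
    rw [hzero, inner_zero_left]
  rw [projQ, sub_apply, one_apply_eq_self, Submodule.starProjection_eq_self_iff.mpr hf, sub_self,
    zero_apply]

end Projections

/-! ### Wiener–Hopf factors -/

section Factors

variable {m : ℕ}

lemma norm_coeff_star (a : Symbol m) (n : ℤ) : ‖(star a).coeff n‖ = ‖a.coeff (-n)‖ := by
  rw [coeff_star, Matrix.norm_conjTranspose]

lemma InWienerKrein.star {a : Symbol m} (h : InWienerKrein a) : InWienerKrein (star a) := by
  constructor
  · exact ((Equiv.neg ℤ).summable_iff.mpr h.1).congr fun n => (norm_coeff_star a n).symm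
  · refine ((Equiv.neg ℤ).summable_iff.mpr h.2).congr fun n => ?_
    simp [norm_coeff_star]

variable {w : (Symbol m)ˣ}

lemma IsPlusFactor.inv (hw : IsPlusFactor w) : IsPlusFactor w⁻¹ :=
  ⟨hw.mem_inv, hw.mem, hw.analytic_inv, hw.analytic⟩

lemma IsMinusFactor.inv (hw : IsMinusFactor w) : IsMinusFactor w⁻¹ :=
  ⟨hw.mem_inv, hw.mem, hw.coanalytic_inv, hw.coanalytic⟩

lemma IsPlusFactor.star (hw : IsPlusFactor w) : IsMinusFactor (star w) :=
  ⟨hw.mem.star, hw.mem_inv.star, isCoanalytic_star hw.analytic, isCoanalytic_star hw.analytic_inv⟩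

lemma IsPlusFactor.preservesH2 (hw : IsPlusFactor w) : PreservesH2 (w : Symbol m) :=
  preservesH2_of_isAnalytic hw.analytic

lemma IsMinusFactor.preservesH2Compl (hw : IsMinusFactor w) : PreservesH2Compl (w : Symbol m) :=
  preservesH2Compl_of_isCoanalytic hw.coanalytic

lemma IsPlusFactor.toeplitz_comp_toeplitz_inv (hw : IsPlusFactor w) :
    toeplitz (w : Symbol m) ∘L toeplitz ((w⁻¹ : (Symbol m)ˣ) : Symbol m) = 1 := by
  rw [← toeplitz_mul_of_right _ hw.inv.preservesH2, w.mul_inv, toeplitz_one]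

lemma IsMinusFactor.toeplitz_comp_toeplitz_inv (hw : IsMinusFactor w) :
    toeplitz (w : Symbol m) ∘L toeplitz ((w⁻¹ : (Symbol m)ˣ) : Symbol m) = 1 := by
  rw [← toeplitz_mul_of_left hw.preservesH2Compl, w.mul_inv, toeplitz_one]

lemma IsMinusFactor.exists_isLogDet (hw : IsMinusFactor w) (β : 𝔻) :
    ∃ ℓ, IsLogDet ((w : Symbol m).comp (mobius (-β))) ℓ :=
  let ⟨ℓ, hℓ, _⟩ := exists_isLogDet_comp_mobius hw.mem.1 hw.coanalytic hw.mem_inv.1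
    hw.coanalytic_inv w.mul_inv β
  ⟨ℓ, hℓ⟩

lemma IsPlusFactor.exists_isLogDet (hw : IsPlusFactor w) (β : 𝔻) :
    ∃ ℓ, IsLogDet ((w : Symbol m).comp (mobius (-β))) ℓ :=
  let ⟨ℓ, hℓ⟩ := hw.star.exists_isLogDet β
  ⟨Star.star ℓ, star_star ((w : Symbol m).comp (mobius (-β))) ▸ isLogDet_star hℓ⟩

lemma IsMinusFactor.detCompress_toeplitz (hw : IsMinusFactor w) (α : ℕ → 𝔻) (N : ℕ) :
    detCompress (toeplitz (w : Symbol m)) (finiteModelSpace α m N) =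
      ∏ j ∈ Finset.range N, geomMean ((w : Symbol m).comp (mobius (-(α j)))) := by
  rw [detCompress_toeplitz_modelSpace α hw.mem.1 hw.coanalytic]
  refine Finset.prod_congr rfl fun j _ => ?_
  obtain ⟨-, -, hmean⟩ := exists_isLogDet_comp_mobius hw.mem.1 hw.coanalytic hw.mem_inv.1
    hw.coanalytic_inv w.mul_inv (α j)
  exact hmean.symm

lemma IsPlusFactor.detCompress_toeplitz (hw : IsPlusFactor w) (α : ℕ → 𝔻) (N : ℕ) :
    detCompress (toeplitz (w : Symbol m)) (finiteModelSpace α m N) =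
      ∏ j ∈ Finset.range N, geomMean ((w : Symbol m).comp (mobius (-(α j)))) := by
  rw [← star_star (w : Symbol m), ← adjoint_toeplitz, detCompress_adjoint, ← Units.coe_star,
    hw.star.detCompress_toeplitz, map_prod]
  refine Finset.prod_congr rfl fun j _ => ?_
  obtain ⟨ℓ, hℓ⟩ := hw.star.exists_isLogDet (α j)
  exact (geomMean_star hℓ).symm

lemma IsMinusFactor.isHilbertSchmidt_outerHankel_mul (hw : IsMinusFactor w) {χ : Symbol m}
    (hχ : InWienerKrein χ) :
    IsHilbertSchmidt (monomialBasis m) (outerHankel ((w : Symbol m) * χ)) := by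
  rw [outerHankel_mul hw.preservesH2Compl]
  exact (isHilbertSchmidt_outerHankel hχ.2).comp_left _

variable {wm wp vp vm : (Symbol m)ˣ}

lemma exists_isLogDet_mul (hvp : IsPlusFactor vp) (hvm : IsMinusFactor vm) (β : 𝔻) :
    ∃ ℓ, IsLogDet ((vp * vm : Symbol m).comp (mobius (-β))) ℓ := by
  obtain ⟨_, hp⟩ := hvp.exists_isLogDet β
  obtain ⟨_, hm⟩ := hvm.exists_isLogDet β
  rw [ContinuousMap.mul_comp]
  exact ⟨_, isLogDet_mul hp hm⟩

lemma geomMean_mul_comp_mobius (hvp : IsPlusFactor vp) (hvm : IsMinusFactor vm) (β : 𝔻) :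
    geomMean ((vp * vm : Symbol m).comp (mobius (-β))) =
      geomMean ((vp : Symbol m).comp (mobius (-β))) *
        geomMean ((vm : Symbol m).comp (mobius (-β))) := by
  obtain ⟨_, hp⟩ := hvp.exists_isLogDet β
  obtain ⟨_, hm⟩ := hvm.exists_isLogDet β
  rw [ContinuousMap.mul_comp, geomMean_mul hp hm]

/-- The operator `T(v₊⁻¹) T(a) T(v₋⁻¹)` for `a = v₊ v₋`. If also `a = w₋ w₊`, then it is the
inverse of `I - H(b) H(c̃) = T(v₋) T(w₊⁻¹) T(w₋⁻¹) T(v₊)`. -/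
def reducedToeplitz (vp vm : (Symbol m)ˣ) : H2 m →L[ℂ] H2 m :=
  toeplitz ((vp⁻¹ : (Symbol m)ˣ) : Symbol m) ∘L toeplitz (vp * vm : Symbol m) ∘L
    toeplitz ((vm⁻¹ : (Symbol m)ˣ) : Symbol m)

lemma toeplitz_eq_comp_reducedToeplitz (hvp : IsPlusFactor vp) (hvm : IsMinusFactor vm) :
    toeplitz (vp * vm : Symbol m) =
      toeplitz (vp : Symbol m) ∘L reducedToeplitz vp vm ∘L toeplitz (vm : Symbol m) := by
  have hvm_inv := hvm.inv.toeplitz_comp_toeplitz_inv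
  rw [inv_inv] at hvm_inv
  rw [reducedToeplitz, ContinuousLinearMap.comp_assoc, ContinuousLinearMap.comp_assoc, hvm_inv,
    ← ContinuousLinearMap.comp_assoc, hvp.toeplitz_comp_toeplitz_inv]
  rfl

lemma mul_inv_mul_inv_mul_eq_one (h : (vp : Symbol m) * vm = wm * wp) :
    (vm : Symbol m) * ((wp⁻¹ : (Symbol m)ˣ) : Symbol m) *
      (((wm⁻¹ : (Symbol m)ˣ) : Symbol m) * vp) = 1 := by
  have hunits : vp * vm = wm * wp := Units.ext h
  have hcomm : vm * wp⁻¹ * (wm⁻¹ * vp) = 1 := by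
    rw [mul_assoc, ← mul_assoc wp⁻¹, ← mul_inv_rev, ← hunits]
    group
  exact congrArg Units.val hcomm

lemma one_sub_hankelProduct_comp_reducedToeplitz (hwm : IsMinusFactor wm) (hwp : IsPlusFactor wp)
    (hvp : IsPlusFactor vp) (hvm : IsMinusFactor vm) (h : (vp : Symbol m) * vm = wm * wp) :
    (1 - hankelProduct ((vm : Symbol m) * ((wp⁻¹ : (Symbol m)ˣ) : Symbol m))
      (((wm⁻¹ : (Symbol m)ˣ) : Symbol m) * vp)) ∘L reducedToeplitz vp vm = 1 := by
  have hwm_inv := hwm.inv.toeplitz_comp_toeplitz_inv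
  have hwp_inv := hwp.inv.toeplitz_comp_toeplitz_inv
  rw [inv_inv] at hwm_inv hwp_inv
  rw [one_sub_hankelProduct (mul_inv_mul_inv_mul_eq_one h), reducedToeplitz, h,
    toeplitz_mul_of_left hvm.preservesH2Compl, toeplitz_mul_of_left hwm.inv.preservesH2Compl,
    toeplitz_mul_of_left hwm.preservesH2Compl]
  ext1 f
  have hcancel {A B : H2 m →L[ℂ] H2 m} (hAB : A ∘L B = 1) (x : H2 m) : A (B x) = x :=
    DFunLike.congr_fun hAB x
  simp only [ContinuousLinearMap.comp_apply, hcancel hvp.toeplitz_comp_toeplitz_inv,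
    hcancel hwm_inv, hcancel hwp_inv, hcancel hvm.toeplitz_comp_toeplitz_inv, one_apply_eq_self]

end Factors

/-! ### The determinant formula -/

section Formula

variable {m : ℕ} {vp vm : (Symbol m)ˣ}

lemma detCompress_toeplitz_mul (hvp : IsPlusFactor vp) (hvm : IsMinusFactor vm) (α : ℕ → 𝔻)
    (N : ℕ) :
    detCompress (toeplitz (vp * vm : Symbol m)) (finiteModelSpace α m N) =
      (∏ j ∈ Finset.range N, geomMean ((vp * vm : Symbol m).comp (mobius (-(α j))))) *
        detCompress (reducedToeplitz vp vm) (finiteModelSpace α m N) := by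
  have hvp_adj : ∀ x ∈ (finiteModelSpace α m N).1,
      ContinuousLinearMap.adjoint (toeplitz (vp : Symbol m)) x ∈ (finiteModelSpace α m N).1 := by
    intro x hx
    rw [adjoint_toeplitz]
    exact toeplitz_mem_modelSpace α hvp.star.preservesH2Compl hx
  have hvm_maps : ∀ x ∈ (finiteModelSpace α m N).1,
      toeplitz (vm : Symbol m) x ∈ (finiteModelSpace α m N).1 :=
    fun x hx => toeplitz_mem_modelSpace α hvm.preservesH2Compl hx
  simp only [geomMean_mul_comp_mobius hvp hvm]
  rw [toeplitz_eq_comp_reducedToeplitz hvp hvm, detCompress_comp_of_adjoint_mapsTo _ hvp_adj,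
    detCompress_comp_of_mapsTo _ hvm_maps, hvp.detCompress_toeplitz, hvm.detCompress_toeplitz,
    Finset.prod_mul_distrib]
  ring

lemma normalizedDet_eq_detCompress (hvp : IsPlusFactor vp) (hvm : IsMinusFactor vm) (α : ℕ → 𝔻)
    (N : ℕ) :
    normalizedDet (vp * vm : Symbol m) α N =
      detCompress (reducedToeplitz vp vm) (finiteModelSpace α m N) := by
  have hprod : ∏ j ∈ Finset.range N,
      geomMean ((vp * vm : Symbol m).comp (mobius (-(α j)))) ≠ 0 := by
    refine Finset.prod_ne_zero_iff.mpr fun j _ => ?_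
    obtain ⟨ℓ, hℓ⟩ := exists_isLogDet_mul hvp hvm (α j)
    rw [geomMean_eq_exp_circleMean hℓ]
    exact Complex.exp_ne_zero _
  change detCompress (toeplitz (vp * vm : Symbol m)) (finiteModelSpace α m N) * _ = _
  rw [detCompress_toeplitz_mul hvp hvm, Finset.prod_inv_distrib, mul_right_comm,
    mul_inv_cancel₀ hprod, one_mul]

variable {b c : Symbol m} (hb : IsHilbertSchmidt (monomialBasis m) (outerHankel b))
  (hc : IsHilbertSchmidt (monomialBasis m) (outerHankel (star c)))

include hb hc

lemma exists_isDetOneSub_hankelProduct : ∃ d, IsDetOneSub (hankelProduct b c) d := by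
  rw [hankelProduct_eq_outerHankel_comp_adjoint]
  exact exists_isDetOneSub_comp_adjoint hb hc

lemma exists_isDetOneSub_projQ_conj (u : 𝔻 → ℂ) :
    ∃ d, IsDetOneSub (projQ m u ∘L hankelProduct b c ∘L projQ m u) d := by
  rw [hankelProduct_eq_outerHankel_comp_adjoint, projQ_eq_starProjection]
  exact exists_isDetOneSub_conj hb hc (isSelfAdjoint_starProjection _)

lemma det_one_sub_hankelProduct_ne_zero {X : H2 m →L[ℂ] H2 m}
    (hX : (1 - hankelProduct b c) ∘L X = 1) {d : ℂ} (hd : IsDetOneSub (hankelProduct b c) d) :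
    d ≠ 0 := by
  rw [hankelProduct_eq_outerHankel_comp_adjoint] at hX hd
  exact det_ne_zero_of_rightInverse hb hc hX hd

lemma tendsto_det_projQ_conj {α : ℕ → 𝔻} {u : 𝔻 → ℂ} {d : ℕ → ℂ} {d₀ : ℂ}
    (hu : ∀ z, Tendsto (fun N => partialBlaschke α N z) atTop (𝓝 (u z)))
    (hd : ∀ N, IsDetOneSub (projQ m (partialBlaschke α N) ∘L hankelProduct b c ∘L
      projQ m (partialBlaschke α N)) (d N))
    (hd₀ : IsDetOneSub (projQ m u ∘L hankelProduct b c ∘L projQ m u) d₀) :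
    Tendsto d atTop (𝓝 d₀) := by
  have hsa (v : 𝔻 → ℂ) : IsSelfAdjoint (projQ m v) :=
    projQ_eq_starProjection m v ▸ isSelfAdjoint_starProjection _
  have hle (v : 𝔻 → ℂ) : ‖projQ m v‖ ≤ 1 :=
    projQ_eq_starProjection m v ▸ Submodule.starProjection_norm_le _
  refine IsDetOneSub.tendsto hd hd₀ fun ε hε => ?_
  rw [hankelProduct_eq_outerHankel_comp_adjoint]
  exact eventually_traceNormLE_conj_sub hb hc (tendsto_projQ hu) (fun N => hle _)
    (fun N => hsa _) (hsa _) hε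

lemma tendsto_normalizedDet (hvp : IsPlusFactor vp) (hvm : IsMinusFactor vm)
    (hinv : (1 - hankelProduct b c) ∘L reducedToeplitz vp vm = 1) {d d₀ : ℂ}
    (hd : IsDetOneSub (hankelProduct b c) d) {α : ℕ → 𝔻} {u : 𝔻 → ℂ}
    (hu : ∀ z, Tendsto (fun N => partialBlaschke α N z) atTop (𝓝 (u z)))
    (hd₀ : IsDetOneSub (projQ m u ∘L hankelProduct b c ∘L projQ m u) d₀) :
    Tendsto (normalizedDet (vp * vm : Symbol m) α) atTop (𝓝 (d₀ / d)) := by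
  choose D hD using fun N => exists_isDetOneSub_projQ_conj hb hc (partialBlaschke α N)
  refine ((tendsto_det_projQ_conj hb hc hu hD hd₀).div_const d).congr fun N => ?_
  have hjacobi : d * detCompress (reducedToeplitz vp vm) (finiteModelSpace α m N) = D N := by
    have hDN := hD N
    rw [projQ_eq_starProjection] at hDN
    exact hd.mul_detCompress_inverse hinv (finiteModelSpace α m N) hDN
  rw [normalizedDet_eq_detCompress hvp hvm, ← hjacobi,
    mul_div_cancel_left₀ _ (det_one_sub_hankelProduct_ne_zero hb hc hinv hd)]

end Formula

end ModelSpace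

end

open ModelSpace in
theorem theorem1p2 (m : ℕ) (a : Symbol m) (wm wp vp vm : (Symbol m)ˣ)
    (ha : InWienerKrein a)
    (hwm : IsMinusFactor wm) (hwp : IsPlusFactor wp)
    (hvp : IsPlusFactor vp) (hvm : IsMinusFactor vm)
    (haw : a = (wm : Symbol m) * wp) (hav : a = (vp : Symbol m) * vm)
    (b c : Symbol m)
    (hb : b = (vm : Symbol m) * ((wp⁻¹ : (Symbol m)ˣ) : Symbol m))
    (hc : c = ((wm⁻¹ : (Symbol m)ˣ) : Symbol m) * vp)
    (α : ℕ → 𝔻) :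
    -- all determinants and geometric means involved are well defined
    (∀ N, FiniteDimensional ℂ (modelSpace m (partialBlaschke α N))) ∧
    (∀ β : 𝔻, ∃ ℓ : C(Circle, ℂ), IsLogDet (a.comp (mobius (-β))) ℓ) ∧
    -- `d = det (I - H(b) H(c̃))`
    ∃ d : ℂ, IsDetOneSub (hankelProduct b c) d ∧ d ≠ 0 ∧
      ((¬ Summable fun j => 1 - ‖(α j : ℂ)‖) →
        (∀ z : 𝔻, Tendsto (fun N => partialBlaschke α N z) atTop (𝓝 0)) ∧
        (∀ f : H2 m, Tendsto (fun N => projQ m (partialBlaschke α N) f) atTop (𝓝 0)) ∧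
        Tendsto (normalizedDet a α) atTop (𝓝 (1 / d))) ∧
      ((Summable fun j => 1 - ‖(α j : ℂ)‖) →
        (∀ z : 𝔻, Multipliable fun j => blaschkeFactor (α j) z) ∧
        (∀ z : 𝔻, Tendsto (fun N => partialBlaschke α N z) atTop (𝓝 (infiniteBlaschke α z))) ∧
        (∀ f : H2 m, Tendsto (fun N => projQ m (partialBlaschke α N) f) atTop
          (𝓝 (projQ m (infiniteBlaschke α) f))) ∧
        -- `dB = det (I - Q_B H(b) H(c̃) Q_B)`
        ∃ dB : ℂ,
          IsDetOneSub (projQ m (infiniteBlaschke α) ∘L hankelProduct b c ∘L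
            projQ m (infiniteBlaschke α)) dB ∧
          Tendsto (normalizedDet a α) atTop (𝓝 (dB / d))) := by
  subst hav hb hc
  have hb := hvm.isHilbertSchmidt_outerHankel_mul hwp.mem_inv
  have hc : IsHilbertSchmidt (monomialBasis m)
      (outerHankel (star (((wm⁻¹ : (Symbol m)ˣ) : Symbol m) * vp))) := by
    rw [star_mul, ← Units.coe_star]
    exact hvp.star.isHilbertSchmidt_outerHankel_mul hwm.mem_inv.star
  have hinv := one_sub_hankelProduct_comp_reducedToeplitz hwm hwp hvp hvm haw
  obtain ⟨d, hd⟩ := exists_isDetOneSub_hankelProduct hb hc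
  refine ⟨finiteDimensional_modelSpace α m, exists_isLogDet_mul hvp hvm, d, hd,
    det_one_sub_hankelProduct_ne_zero hb hc hinv hd, fun hα => ?_, fun hα => ?_⟩
  · have hu := tendsto_partialBlaschke_zero hα
    refine ⟨hu, fun f => by simpa [projQ_zero] using tendsto_projQ hu f, ?_⟩
    exact tendsto_normalizedDet hb hc hvp hvm hinv hd hu
      (by simpa [projQ_zero] using isDetOneSub_zero)
  · have hu := tendsto_partialBlaschke hα
    obtain ⟨dB, hdB⟩ := exists_isDetOneSub_projQ_conj hb hc (infiniteBlaschke α)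
    exact ⟨multipliable_blaschkeFactor hα, hu, tendsto_projQ hu, dB, hdB,
      tendsto_normalizedDet hb hc hvp hvm hinv hd hu hdB⟩
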